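/- Let $\mathbf k$ be a field, $H_0$ a Hopf algebra over $\mathbf k$ with bijective antipode $S$, and $V=\bigoplus_{i=1}^d V_i$ a direct sum of (left-left) Yetter-Drinfeld modules over $H_0$, with action $h.v$ and coaction $\delta(v)=v_{(-1)}\otimes v_{(0)}$. The tensor algebra $TV$ carries the induced action and coaction, the braiding $c(x\otimes y)=x_{(-1)}.y\otimes x_{(0)}$, and the braided coproduct $\Delta_{TV}(r)=r^{(1)}\otimes r^{(2)}$, the algebra map from $TV$ to the braided tensor product of $TV$ with itself with $\Delta_{TV}(v)=v\otimes1+1\otimes v$ for $v\in V$. The smash product $TV\#H_0$ is $TV\otimes H_0$ with product $(r\#h)(s\#g)=r(h_{(1)}.s)\#h_{(2)}g$ and coproduct $\Delta(r\#h)=(r^{(1)}\#{r^{(2)}}_{(-1)}h_{(1)})\otimes({r^{(2)}}_{(0)}\#h_{(2)})$; it contains $TV$ and $H_0$. Put $T^+V=\bigoplus_{n\ge1}V^{\otimes n}$ and $[x,y]=xy-\mathrm m\,c^{-1}(x\otimes y)$ for $x,y\in TV$, where $\mathrm m$ is the multiplication of $TV$. Order words in the alphabet $\{1<\dots<d\}$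 lexicographically (a proper prefix is smaller). A nonempty word $u$ is Lyndon if $u<u_2$ whenever $u=u_1u_2$ with $u_1,u_2$ nonempty. The Shirshov decomposition of a Lyndon word $u$ of length $|u|\ge2$ is $u=vw$, where $w$ is the longest proper right factor of $u$ that is Lyndon ($v$ is then Lyndon as well). A monotonic super-word is a finite sequence $v_1\cdots v_r$ of Lyndon words with $v_1\ge\dots\ge v_r$. For a Lyndon word $u$ let $M_{>u}$ be the set of those with $r\ge1$ and $v_r>u$. For a word $u=a_1\cdots a_m$ the elements of $V^u=V_{a_1}\otimes\cdots\otimes V_{a_m}\subseteq V^{\otimes m}$ are called $u$-vectors. Define $[x]$ linearly in the $u$-vector $x$ as follows. If $|u|\le 1$, then $[x]=x$. If $u$ is Lyndon with $|u|\ge2$ and Shirshov decomposition $u=vw$, then $[x]=[[x_v],[x_w]]$, where $x=x_v\otimes x_w\in V^v\otimes V^w$ (in general a sum of tensors). If $u$ is the concatenation of a monotonic super-word $v_1\cdots v_r$, then $[x]=[x_{v_1}]\cdots[x_{v_r}]$, where $x=x_{v_1}\otimes\cdots\otimes x_{v_r}$. For $u$ Lyndon (resp. for $w$ a monotonic super-word)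 the elements $[x]$, with $x$ a $u$-vector (resp. a $w$-vector), are called $u$-$[\,]$-letters (resp. $w$-$[\,]$-words). **Proposition.** Let $u$ be a Lyndon word and let $X\in TV\subseteq TV\#H_0$ be a $u$-$[\,]$-letter. Then there is a finite family of elements $X'_i,X''_i\in T^+V$ and $h_i\in H_0$ such that $$\Delta(X)=X\otimes1+X_{(-1)}\otimes X_{(0)}+\sum_i (X'_ih_i)\otimes X''_i ,$$ and each $X'_i$ is a $w_i$-$[\,]$-word for some $w_i\in M_{>u}$. -/

import Mathlib

open scoped TensorProduct

namespace LyndonHopf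

noncomputable section

/-! ## Lyndon words and monotonic super-words

Words on the totally ordered alphabet `A` are lists; `<` on `List A` is the lexicographic order
(a proper prefix is smaller). -/

section Words

variable {A : Type*} [LinearOrder A]

/-- A nonempty word `u` is a Lyndon word if `u = u₁u₂` with `u₁, u₂` nonempty implies `u < u₂`. -/
def IsLyndon (u : List A) : Prop :=
  u ≠ [] ∧ ∀ u₁ u₂ : List A, u₁ ≠ [] → u₂ ≠ [] → u = u₁ ++ u₂ → u < u₂

/-- A super-word (a word whose letters are words) is monotonic if all its super-letters are
Lyndon words and it is non-increasing. It may be empty. -/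
def IsMonotonic (w : List (List A)) : Prop :=
  (∀ v ∈ w, IsLyndon v) ∧ w.Pairwise (fun v v' => v' ≤ v)

/-- The set `M_{>u}` of nonempty monotonic super-words all of whose super-letters are `> u`. -/
def MonotonicGT (u : List A) : Set (List (List A)) :=
  {w | IsMonotonic w ∧ w ≠ [] ∧ ∀ v ∈ w, u < v}

/-- The length `|v|` of the left factor of the Shirshov decomposition `u = vw`: the right factor
`w` is the longest proper right factor of `u` which is a Lyndon word. -/
def shirshovIndex (u : List A) : ℕ := sInf {i | 1 ≤ i ∧ IsLyndon (u.drop i)}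

theorem isLyndon_singleton (a : A) : IsLyndon [a] := by
  refine ⟨by simp, fun u₁ u₂ h₁ h₂ h => ?_⟩
  have h' := congrArg List.length h
  have := List.length_pos_iff.mpr h₁
  have := List.length_pos_iff.mpr h₂
  simp only [List.length_singleton, List.length_append] at h'
  omega

theorem shirshovIndex_spec {u : List A} (hu : ¬ u.length ≤ 1) :
    1 ≤ shirshovIndex u ∧ shirshovIndex u < u.length := by
  have hne : {i | 1 ≤ i ∧ IsLyndon (u.drop i)}.Nonempty := by
    refine ⟨u.length - 1, by omega, ?_⟩
    have hl : (u.drop (u.length - 1)).length = 1 := by simp; omega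
    obtain ⟨a, ha⟩ := List.length_eq_one_iff.mp hl
    rw [ha]
    exact isLyndon_singleton a
  have h := Nat.sInf_mem hne
  refine ⟨h.1, ?_⟩
  by_contra hcon
  exact h.2.1 (List.drop_eq_nil_of_le (not_lt.mp hcon))

end Words

/-! ## Module algebras, comodules, comodule algebras, Yetter-Drinfeld modules -/

section Classes

variable (k H : Type*) [Field k] [Ring H]

/-- A (left) `H`-module algebra structure on the algebra `A`; `act h x` is `h . x`. -/
class ModuleAlgebra [Bialgebra k H] (A : Type*) [Ring A] [Algebra k A] where
  act : H →ₗ[k] A →ₗ[k] A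
  one_act : act 1 = LinearMap.id
  mul_act : ∀ g h : H, act (g * h) = act g ∘ₗ act h
  act_one : ∀ h : H, act h 1 = algebraMap k A (Coalgebra.counit h)
  /-- `h . (xy) = (h₍₁₎ . x)(h₍₂₎ . y)`. -/
  act_mul : ∀ (h : H) (x y : A), act h (x * y) =
    LinearMap.mul' k A (TensorProduct.map (act.flip x) (act.flip y) (Coalgebra.comul h))

/-- A left `H`-comodule structure `δ(m) = m₍₋₁₎ ⊗ m₍₀₎` on the vector space `M`. -/
class LeftComodule [Bialgebra k H] (M : Type*) [AddCommGroup M] [Module k M] where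
  coact : M →ₗ[k] H ⊗[k] M
  coassoc : ∀ m : M, TensorProduct.assoc k H H M (Coalgebra.comul.rTensor M (coact m)) =
    coact.lTensor H (coact m)
  counit_coact : ∀ m : M, Coalgebra.counit.rTensor M (coact m) = (1 : k) ⊗ₜ[k] m

/-- A left `H`-comodule algebra: the coaction is a morphism of algebras `B → H ⊗ B`. -/
class ComoduleAlgebra [Bialgebra k H] (B : Type*) [Ring B] [Algebra k B]
    extends LeftComodule k H B where
  coact_one : coact 1 = 1
  coact_mul : ∀ b b' : B, coact (b * b') = coact b * coact b'

/-- For `t = v₍₋₁₎ ⊗ v₍₀₎`, the linear map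
`(h₍₁₎ ⊗ h₍₂₎) ⊗ h₍₃₎ ↦ h₍₁₎ v₍₋₁₎ S(h₍₃₎) ⊗ h₍₂₎ . v₍₀₎`. -/
def ydTwist [HopfAlgebra k H] (M : Type*) [AddCommGroup M] [Module k M] [Module H M]
    [IsScalarTower k H M] (t : H ⊗[k] M) : (H ⊗[k] H) ⊗[k] H →ₗ[k] H ⊗[k] M :=
  TensorProduct.lift <|
    (LinearMap.rTensorHom M ∘ₗ (LinearMap.mul k H).flip ∘ₗ HopfAlgebra.antipode k).flip ∘ₗ
      (TensorProduct.map₂ (LinearMap.mul k H) (Algebra.lsmul k k M).toLinearMap).flip t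

/-- A (left-left) Yetter-Drinfeld module over the Hopf algebra `H`: a left module and left comodule
with `δ(h . v) = h₍₁₎ v₍₋₁₎ S(h₍₃₎) ⊗ h₍₂₎ . v₍₀₎`. -/
class YetterDrinfeldModule [HopfAlgebra k H] (M : Type*) [AddCommGroup M] [Module k M]
    [Module H M] [IsScalarTower k H M] extends LeftComodule k H M where
  coact_smul : ∀ (h : H) (v : M), coact (h • v) =
    ydTwist k H M (coact v) (Coalgebra.comul.rTensor H (Coalgebra.comul h))

/-- A subspace which is a submodule and a subcomodule (hence a Yetter-Drinfeld submodule). -/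
def IsYDSubmodule [HopfAlgebra k H] {M : Type*} [AddCommGroup M] [Module k M]
    [Module H M] [IsScalarTower k H M] [YetterDrinfeldModule k H M] (W : Submodule k M) : Prop :=
  (∀ (h : H), ∀ v ∈ W, h • v ∈ W) ∧
    ∀ v ∈ W, LeftComodule.coact (k := k) (H := H) v ∈ LinearMap.range (W.subtype.lTensor H)

/-- `H` is a left comodule algebra over itself via its coproduct. -/
instance selfComoduleAlgebra [Bialgebra k H] : ComoduleAlgebra k H H where
  coact := Coalgebra.comul
  coassoc := Coalgebra.coassoc_apply
  counit_coact := Coalgebra.rTensor_counit_comul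
  coact_one := Bialgebra.comul_one
  coact_mul := Bialgebra.comul_mul

end Classes

/-! ## Smash products

For an `H`-module algebra `A` and an `H`-comodule algebra `B`, the vector space `A ⊗ B` is an algebra
with `(a ⊗ b)(a' ⊗ b') = a (b₍₋₁₎ . a') ⊗ b₍₀₎ b'`. For `B = H` this is the smash product `A # H`.
For `A = B` the tensor algebra of a Yetter-Drinfeld module, this is the braided tensor product
`(a ⊗ b)(a' ⊗ b') = a c(b ⊗ a') b'`, where `c(x ⊗ y) = x₍₋₁₎ . y ⊗ x₍₀₎`. -/

section Smash

set_option linter.unusedSectionVars false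

variable (k H A B : Type*) [Field k] [Ring H] [Bialgebra k H] [Ring A] [Algebra k A]
  [Ring B] [Algebra k B] [ModuleAlgebra k H A] [ComoduleAlgebra k H B]

/-- The underlying vector space `A ⊗ B` of the smash product. -/
@[nolint unusedArguments]
def Smash (k H A B : Type*) [Field k] [Ring H] [Bialgebra k H] [Ring A] [Algebra k A]
    [Ring B] [Algebra k B] [ModuleAlgebra k H A] [ComoduleAlgebra k H B] : Type _ := A ⊗[k] B

namespace Smash

instance : AddCommGroup (Smash k H A B) := inferInstanceAs (AddCommGroup (A ⊗[k] B))
instance : Module k (Smash k H A B) := inferInstanceAs (Module k (A ⊗[k] B))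

/-- The identity map `A ⊗ B → A # B`. -/
def ofTensor : A ⊗[k] B ≃ₗ[k] Smash k H A B := LinearEquiv.refl k (A ⊗[k] B)

/-- `b ↦ (a' ⊗ b' ↦ b₍₋₁₎ . a' ⊗ b₍₀₎ b')`. -/
def mulRightFactor : B →ₗ[k] Module.End k (A ⊗[k] B) :=
  TensorProduct.map₂ (ModuleAlgebra.act (k := k) (H := H) (A := A)) (LinearMap.mul k B) ∘ₗ
    LeftComodule.coact (k := k) (H := H) (M := B)

/-- `a ↦ (a' ⊗ b' ↦ a a' ⊗ b')`. -/
def mulLeftFactor : A →ₗ[k] Module.End k (A ⊗[k] B) :=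
  LinearMap.rTensorHom B ∘ₗ LinearMap.mul k A

/-- The multiplication `(a ⊗ b)(a' ⊗ b') = a (b₍₋₁₎ . a') ⊗ b₍₀₎ b'`. -/
def mulMap : A ⊗[k] B →ₗ[k] Module.End k (A ⊗[k] B) :=
  TensorProduct.lift ((LinearMap.mul k (Module.End k (A ⊗[k] B))).compl₁₂
    (mulLeftFactor k A B) (mulRightFactor k H A B))

theorem mulMap_tmul (a : A) (b : B) :
    mulMap k H A B (a ⊗ₜ b) = mulLeftFactor k A B a * mulRightFactor k H A B b := by
  simp [mulMap]

theorem mulLeftFactor_mul (a a' : A) :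
    mulLeftFactor k A B (a * a') = mulLeftFactor k A B a * mulLeftFactor k A B a' := by
  ext; simp [mulLeftFactor, mul_assoc]

theorem map₂_mul (s t : H ⊗[k] B) :
    TensorProduct.map₂ (ModuleAlgebra.act (k := k) (H := H) (A := A)) (LinearMap.mul k B) (s * t) =
      TensorProduct.map₂ (ModuleAlgebra.act (k := k) (H := H) (A := A)) (LinearMap.mul k B) s *
      TensorProduct.map₂ (ModuleAlgebra.act (k := k) (H := H) (A := A)) (LinearMap.mul k B) t := by
  induction s with
  | zero => simp
  | add s s' hs hs' => simp [add_mul, hs, hs']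
  | tmul g b =>
    induction t with
    | zero => simp
    | add t t' ht ht' => simp [mul_add, ht, ht']
    | tmul g' b' =>
      ext a c
      simp [ModuleAlgebra.mul_act, mul_assoc]

theorem mulRightFactor_mul (b b' : B) :
    mulRightFactor k H A B (b * b') = mulRightFactor k H A B b * mulRightFactor k H A B b' := by
  simp [mulRightFactor, ComoduleAlgebra.coact_mul, map₂_mul]

theorem mulMap_mulLeftFactor (a : A) (y : A ⊗[k] B) :
    mulMap k H A B (mulLeftFactor k A B a y) = mulLeftFactor k A B a * mulMap k H A B y := by
  induction y with
  | zero => simp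
  | add y y' hy hy' => simp [hy, hy', mul_add]
  | tmul a' b' =>
    have : mulLeftFactor k A B a (a' ⊗ₜ b') = (a * a') ⊗ₜ b' := by simp [mulLeftFactor]
    rw [this, mulMap_tmul, mulMap_tmul, mulLeftFactor_mul, mul_assoc]

/-- `h ⊗ (g ⊗ e) ↦ (h . a)(g . c) ⊗ e d`. -/
def hexAux (a c : A) (d : B) : H ⊗[k] (H ⊗[k] B) →ₗ[k] A ⊗[k] B :=
  TensorProduct.lift <| ((mulLeftFactor k A B) ∘ₗ
    (ModuleAlgebra.act (k := k) (H := H) (A := A)).flip a).compl₂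
      (TensorProduct.map ((ModuleAlgebra.act (k := k) (H := H) (A := A)).flip c)
        ((LinearMap.mul k B).flip d))

theorem mulRightFactor_comp (b : B) (a : A) :
    mulMap k H A B (TensorProduct.map ((ModuleAlgebra.act (k := k) (H := H) (A := A)).flip a)
      LinearMap.id (LeftComodule.coact (k := k) (H := H) b)) =
      mulRightFactor k H A B b * mulLeftFactor k A B a := by
  ext c d
  have key := congrArg (hexAux k H A B a c d) (LeftComodule.coassoc (k := k) (H := H) b)
  have h1 : ∀ t : H ⊗[k] B, hexAux k H A B a c d
      ((LeftComodule.coact (k := k) (H := H) (M := B)).lTensor H t) =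
      mulMap k H A B (TensorProduct.map ((ModuleAlgebra.act (k := k) (H := H) (A := A)).flip a)
        LinearMap.id t) (c ⊗ₜ d) := by
    intro t
    induction t with
    | zero => simp
    | add t t' ht ht' => simp [ht, ht']
    | tmul h e =>
      have : ∀ s : H ⊗[k] B, TensorProduct.map₂ (ModuleAlgebra.act (k := k) (H := H) (A := A))
          (LinearMap.mul k B) s (c ⊗ₜ d) = TensorProduct.map
            ((ModuleAlgebra.act (k := k) (H := H) (A := A)).flip c)
            ((LinearMap.mul k B).flip d) s := by
        intro s
        induction s with
        | zero => simp
        | add s s' hs hs' => simp [hs, hs']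
        | tmul g f => simp
      simp [hexAux, mulMap_tmul, mulRightFactor, this]
  have h2 : ∀ t : H ⊗[k] B, hexAux k H A B a c d
      (TensorProduct.assoc k H H B (Coalgebra.comul.rTensor B t)) =
      TensorProduct.map₂ (ModuleAlgebra.act (k := k) (H := H) (A := A)) (LinearMap.mul k B) t
        (mulLeftFactor k A B a (c ⊗ₜ d)) := by
    intro t
    induction t with
    | zero => simp
    | add t t' ht ht' => simp [ht, ht']
    | tmul h e =>
      have : ∀ s : H ⊗[k] H, hexAux k H A B a c d (TensorProduct.assoc k H H B (s ⊗ₜ e)) =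
          LinearMap.mul' k A (TensorProduct.map
            ((ModuleAlgebra.act (k := k) (H := H) (A := A)).flip a)
            ((ModuleAlgebra.act (k := k) (H := H) (A := A)).flip c) s) ⊗ₜ (e * d) := by
        intro s
        induction s with
        | zero => simp
        | add s s' hs hs' => simp [hs, hs', TensorProduct.add_tmul]
        | tmul g f => simp [hexAux, mulLeftFactor]
      simp [this, mulLeftFactor, ModuleAlgebra.act_mul]
  rw [h1, h2] at key
  simpa [mulRightFactor] using key.symm

theorem mulMap_mulRightFactor (b : B) (y : A ⊗[k] B) :
    mulMap k H A B (mulRightFactor k H A B b y) = mulRightFactor k H A B b * mulMap k H A B y := by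
  have hR : ∀ (x : A ⊗[k] B) (b' : B),
      mulMap k H A B (((LinearMap.mul k B).flip b').lTensor A x) =
        mulMap k H A B x * mulRightFactor k H A B b' := by
    intro x b'
    induction x with
    | zero => simp
    | add x x' hx hx' => simp [hx, hx', add_mul]
    | tmul a c =>
      rw [LinearMap.lTensor_tmul, LinearMap.flip_apply, LinearMap.mul_apply', mulMap_tmul,
        mulMap_tmul, mulRightFactor_mul, mul_assoc]
  induction y with
  | zero => simp
  | add y y' hy hy' => simp [hy, hy', mul_add]
  | tmul a b' =>
    have : mulRightFactor k H A B b (a ⊗ₜ b') = ((LinearMap.mul k B).flip b').lTensor A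
        (TensorProduct.map ((ModuleAlgebra.act (k := k) (H := H) (A := A)).flip a)
          LinearMap.id (LeftComodule.coact (k := k) (H := H) b)) := by
      simp only [mulRightFactor, LinearMap.comp_apply]
      generalize LeftComodule.coact (k := k) (H := H) b = t
      induction t with
      | zero => simp
      | add t t' ht ht' => simp [ht, ht']
      | tmul g f => simp
    rw [this, hR, mulRightFactor_comp, mulMap_tmul, mul_assoc]

theorem mulMap_mulMap (x y : A ⊗[k] B) :
    mulMap k H A B (mulMap k H A B x y) = mulMap k H A B x * mulMap k H A B y := by
  induction x with
  | zero => simp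
  | add x x' hx hx' => simp [hx, hx', add_mul]
  | tmul a b =>
    rw [mulMap_tmul, Module.End.mul_apply, mulMap_mulLeftFactor, mulMap_mulRightFactor, mul_assoc]

theorem mulMap_one : mulMap k H A B (1 ⊗ₜ 1) = 1 := by
  ext a b
  simp [mulMap_tmul, mulLeftFactor, mulRightFactor, ComoduleAlgebra.coact_one,
    Algebra.TensorProduct.one_def, ModuleAlgebra.one_act]

theorem mulMap_apply_one (x : A ⊗[k] B) : mulMap k H A B x (1 ⊗ₜ 1) = x := by
  induction x with
  | zero => simp
  | add x x' hx hx' => simp [hx, hx']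
  | tmul a b =>
    have h : ∀ t : H ⊗[k] B, TensorProduct.map₂ (ModuleAlgebra.act (k := k) (H := H) (A := A))
        (LinearMap.mul k B) t (1 ⊗ₜ 1) =
          (Algebra.linearMap k A).rTensor B (Coalgebra.counit.rTensor B t) := by
      intro t
      induction t with
      | zero => simp
      | add t t' ht ht' => simp [ht, ht']
      | tmul g f => simp [ModuleAlgebra.act_one]
    simp [mulMap_tmul, mulLeftFactor, mulRightFactor, h, LeftComodule.counit_coact]

instance : Ring (Smash k H A B) where
  __ := (inferInstance : AddCommGroup (Smash k H A B))
  mul x y := mulMap k H A B x y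
  one := (1 : A) ⊗ₜ[k] (1 : B)
  left_distrib x y z := map_add (mulMap k H A B x) y z
  right_distrib x y z := LinearMap.congr_fun (map_add (mulMap k H A B) x y) z
  zero_mul x := LinearMap.congr_fun (map_zero (mulMap k H A B)) x
  mul_zero x := map_zero (mulMap k H A B x)
  mul_assoc x y z := LinearMap.congr_fun (mulMap_mulMap k H A B x y) z
  one_mul x := LinearMap.congr_fun (mulMap_one k H A B) x
  mul_one x := mulMap_apply_one k H A B x

instance : Algebra k (Smash k H A B) :=
  Algebra.ofModule (fun r x y => LinearMap.congr_fun (map_smul (mulMap k H A B) r x) y)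
    (fun r x y => map_smul (mulMap k H A B x) r y)

/-- The embedding `A ⊆ A # B`, `a ↦ a ⊗ 1`. -/
def inl : A →ₗ[k] Smash k H A B :=
  (ofTensor k H A B).toLinearMap ∘ₗ (TensorProduct.mk k A B).flip 1

/-- The embedding `B ⊆ A # B`, `b ↦ 1 ⊗ b`. -/
def inr : B →ₗ[k] Smash k H A B :=
  (ofTensor k H A B).toLinearMap ∘ₗ TensorProduct.mk k A B 1

end Smash

end Smash

/-! ## The tensor algebra of a Yetter-Drinfeld module -/

section TensorAlg

variable (k H V : Type*) [Field k] [Ring H] [HopfAlgebra k H] [AddCommGroup V] [Module k V]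
  [Module H V] [IsScalarTower k H V]

/-- The action of `H` on `TV`, encoded as the algebra morphism from `TV` to the convolution algebra
`Hom(H, TV)` which sends `v ∈ V` to `h ↦ h . v`. -/
def tensorActHom : TensorAlgebra k V →ₐ[k] WithConv (H →ₗ[k] TensorAlgebra k V) :=
  TensorAlgebra.lift k <| (WithConv.linearEquiv k (H →ₗ[k] TensorAlgebra k V)).symm.toLinearMap ∘ₗ
    ((Algebra.lsmul k k V).toLinearMap.compr₂ (TensorAlgebra.ι k)).flip

variable {k H V}

theorem tensorActHom_ι (v : V) (h : H) :
    (tensorActHom k H V (TensorAlgebra.ι k v)) h = TensorAlgebra.ι k (h • v) := by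
  simp [tensorActHom]

theorem tensorActHom_mul (x y : TensorAlgebra k V) (h : H) :
    (tensorActHom k H V (x * y)) h = LinearMap.mul' k (TensorAlgebra k V)
      (TensorProduct.map (tensorActHom k H V x).ofConv (tensorActHom k H V y).ofConv
        (Coalgebra.comul h)) := by
  rw [map_mul, LinearMap.convMul_apply]

theorem tensorActHom_algebraMap (r : k) (h : H) :
    (tensorActHom k H V (algebraMap k _ r)) h = algebraMap k _ (r * Coalgebra.counit h) := by
  rw [AlgHom.commutes, LinearMap.convAlgebraMap_apply, map_mul, Algebra.smul_def]

variable (k H V)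

/-- The action of `H` on `TV`: `h . (v₁⋯vₙ) = (h₍₁₎ . v₁)⋯(h₍ₙ₎ . vₙ)`. -/
instance tensorModuleAlgebra : ModuleAlgebra k H (TensorAlgebra k V) where
  act := ((WithConv.linearEquiv k (H →ₗ[k] TensorAlgebra k V)).toLinearMap ∘ₗ
    (tensorActHom k H V).toLinearMap).flip
  one_act := by
    ext x
    simp only [LinearMap.flip_apply, LinearMap.comp_apply, AlgHom.toLinearMap_apply,
      LinearEquiv.coe_coe, WithConv.linearEquiv_apply, LinearMap.id_apply]
    induction x using TensorAlgebra.induction with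
    | algebraMap r => rw [tensorActHom_algebraMap]; simp
    | ι v => rw [tensorActHom_ι, one_smul]
    | mul x y hx hy =>
      rw [tensorActHom_mul, Bialgebra.comul_one, Algebra.TensorProduct.one_def]
      simp [hx, hy]
    | add x y hx hy => simp [hx, hy]
  mul_act g h := by
    ext x
    simp only [LinearMap.flip_apply, LinearMap.comp_apply, AlgHom.toLinearMap_apply,
      LinearEquiv.coe_coe, WithConv.linearEquiv_apply]
    induction x using TensorAlgebra.induction generalizing g h with
    | algebraMap r =>
      rw [tensorActHom_algebraMap, tensorActHom_algebraMap, tensorActHom_algebraMap,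
        Bialgebra.counit_mul, mul_assoc, mul_comm (Coalgebra.counit g)]
    | ι v => rw [tensorActHom_ι, tensorActHom_ι, tensorActHom_ι, mul_smul]
    | mul x y hx hy =>
      rw [tensorActHom_mul, Bialgebra.comul_mul, tensorActHom_mul]
      generalize Coalgebra.comul (R := k) h = t
      induction t with
      | zero => simp
      | add t t' ht ht' => simp [mul_add, ht, ht']
      | tmul c d =>
        simp only [TensorProduct.map_tmul, LinearMap.mul'_apply]
        rw [tensorActHom_mul]
        generalize Coalgebra.comul (R := k) g = s
        induction s with
        | zero => simp
        | add s s' hs hs' => simp [add_mul, hs, hs']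
        | tmul a b => simp [hx, hy]
    | add x y hx hy => simp [hx, hy]
  act_one h := by
    have := tensorActHom_algebraMap (k := k) (V := V) 1 h
    rwa [map_one, one_mul] at this
  act_mul h x y := tensorActHom_mul x y h

variable [YetterDrinfeldModule k H V]

/-- The coaction of `H` on `TV`: the algebra morphism `TV → H ⊗ TV` extending
`v ↦ v₍₋₁₎ ⊗ v₍₀₎`. -/
def tensorCoactHom : TensorAlgebra k V →ₐ[k] H ⊗[k] TensorAlgebra k V :=
  TensorAlgebra.lift k ((TensorAlgebra.ι k).lTensor H ∘ₗ LeftComodule.coact)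

variable {k H V}

theorem tensorCoactHom_ι (v : V) : tensorCoactHom k H V (TensorAlgebra.ι k v) =
    (TensorAlgebra.ι k).lTensor H (LeftComodule.coact v) := by
  simp [tensorCoactHom]

variable (k H V)

instance tensorComoduleAlgebra : ComoduleAlgebra k H (TensorAlgebra k V) where
  coact := (tensorCoactHom k H V).toLinearMap
  coassoc x := by
    have key : ((Algebra.TensorProduct.assoc k k k H H (TensorAlgebra k V)).toAlgHom.comp
        (Algebra.TensorProduct.map (Bialgebra.comulAlgHom k H) (AlgHom.id k _))).comp
        (tensorCoactHom k H V) =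
        (Algebra.TensorProduct.map (AlgHom.id k H) (tensorCoactHom k H V)).comp
          (tensorCoactHom k H V) := by
      ext v
      have h := congrArg (((TensorAlgebra.ι k).lTensor H).lTensor H)
        (LeftComodule.coassoc (k := k) (H := H) v)
      simp only [LinearMap.comp_apply, AlgHom.toLinearMap_apply, AlgHom.comp_apply,
        tensorCoactHom_ι]
      generalize LeftComodule.coact (k := k) (H := H) v = t at h
      have e1 : ∀ t : H ⊗[k] V, ((TensorAlgebra.ι k).lTensor H).lTensor H
          (TensorProduct.assoc k H H V (Coalgebra.comul.rTensor V t)) =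
          (Algebra.TensorProduct.assoc k k k H H (TensorAlgebra k V)).toAlgHom
            (Algebra.TensorProduct.map (Bialgebra.comulAlgHom k H) (AlgHom.id k _)
              ((TensorAlgebra.ι k).lTensor H t)) := by
        intro t
        induction t with
        | zero => simp
        | add t t' ht ht' => simp only [map_add, ht, ht']
        | tmul g w =>
          simp only [LinearMap.rTensor_tmul, LinearMap.lTensor_tmul,
            Algebra.TensorProduct.map_tmul, Bialgebra.comulAlgHom_apply, AlgHom.id_apply]
          generalize Coalgebra.comul (R := k) g = s
          induction s with
          | zero => simp
          | add s s' hs hs' => simp only [TensorProduct.add_tmul, map_add, hs, hs']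
          | tmul a b => simp
      have e2 : ∀ t : H ⊗[k] V, ((TensorAlgebra.ι k).lTensor H).lTensor H
          ((LeftComodule.coact (k := k) (H := H) (M := V)).lTensor H t) =
          Algebra.TensorProduct.map (AlgHom.id k H) (tensorCoactHom k H V)
              ((TensorAlgebra.ι k).lTensor H t) := by
        intro t
        induction t with
        | zero => simp
        | add t t' ht ht' => simp only [map_add, ht, ht']
        | tmul g w => simp [tensorCoactHom_ι]
      rw [← e1, ← e2, h]
    have h := DFunLike.congr_fun key x
    simp only [AlgHom.comp_apply] at h
    generalize hT : tensorCoactHom k H V x = T at h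
    have a1 : (Algebra.TensorProduct.assoc k k k H H (TensorAlgebra k V)).toAlgHom
          (Algebra.TensorProduct.map (Bialgebra.comulAlgHom k H) (AlgHom.id k _) T) =
        TensorProduct.assoc k H H (TensorAlgebra k V) (Coalgebra.comul.rTensor _ T) := rfl
    have a2 : Algebra.TensorProduct.map (AlgHom.id k H) (tensorCoactHom k H V) T =
        (tensorCoactHom k H V).toLinearMap.lTensor H T := rfl
    simp only [AlgHom.toLinearMap_apply, hT]
    rw [← a1, ← a2, h]
  counit_coact x := by
    have key : (Algebra.TensorProduct.map (Bialgebra.counitAlgHom k H)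
        (AlgHom.id k (TensorAlgebra k V))).comp (tensorCoactHom k H V) =
        Algebra.TensorProduct.includeRight := by
      ext v
      have h := congrArg ((TensorAlgebra.ι k).lTensor k)
        (LeftComodule.counit_coact (k := k) (H := H) v)
      simp only [LinearMap.comp_apply, AlgHom.toLinearMap_apply, AlgHom.comp_apply,
        tensorCoactHom_ι]
      have e1 : ∀ t : H ⊗[k] V, (TensorAlgebra.ι k).lTensor k (Coalgebra.counit.rTensor V t) =
          Algebra.TensorProduct.map (Bialgebra.counitAlgHom k H) (AlgHom.id k _)
            ((TensorAlgebra.ι k).lTensor H t) := by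
        intro t
        induction t with
        | zero => simp
        | add t t' ht ht' => simp only [map_add, ht, ht']
        | tmul g w => simp
      rw [← e1, h]
      simp
    exact DFunLike.congr_fun key x
  coact_one := map_one (tensorCoactHom k H V)
  coact_mul := map_mul (tensorCoactHom k H V)

/-- The braided coproduct `Δ_{TV}`: the algebra morphism from `TV` to the braided tensor product
algebra of `TV` with itself such that `Δ_{TV}(v) = v ⊗ 1 + 1 ⊗ v` for `v ∈ V`. -/
def braidedComul :
    TensorAlgebra k V →ₐ[k] Smash k H (TensorAlgebra k V) (TensorAlgebra k V) :=
  TensorAlgebra.lift k ((Smash.inl k H (TensorAlgebra k V) (TensorAlgebra k V) +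
    Smash.inr k H (TensorAlgebra k V) (TensorAlgebra k V)) ∘ₗ TensorAlgebra.ι k)

/-- The smash product algebra `TV # H`, with `(r # h)(s # g) = r (h₍₁₎ . s) # h₍₂₎ g`. -/
abbrev TensorSmash : Type _ := Smash k H (TensorAlgebra k V) H

/-- The linear map
`(r ⊗ s) ⊗ (h ⊗ h') ↦ (r # s₍₋₁₎ h) ⊗ (s₍₀₎ # h')`. -/
def smashComulAux :
    (TensorAlgebra k V ⊗[k] TensorAlgebra k V) ⊗[k] (H ⊗[k] H) →ₗ[k]
      TensorSmash k H V ⊗[k] TensorSmash k H V :=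
  let T := TensorAlgebra k V
  TensorProduct.map
      ((Smash.ofTensor k H T H).toLinearMap ∘ₗ (LinearMap.mul' k H).lTensor T ∘ₗ
        (TensorProduct.assoc k T H H).toLinearMap)
      (Smash.ofTensor k H T H).toLinearMap ∘ₗ
    (TensorProduct.tensorTensorTensorComm k (T ⊗[k] H) T H H).toLinearMap ∘ₗ
    ((TensorProduct.assoc k T H T).symm.toLinearMap ∘ₗ
      (LeftComodule.coact (k := k) (H := H) (M := T)).lTensor T).rTensor (H ⊗[k] H)

/-- The coproduct of `TV # H`:
`Δ(r # h) = (r⁽¹⁾ # r⁽²⁾₍₋₁₎ h₍₁₎) ⊗ (r⁽²⁾₍₀₎ # h₍₂₎)`, where `Δ_{TV}(r) = r⁽¹⁾ ⊗ r⁽²⁾`. -/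
def smashComul : TensorSmash k H V →ₗ[k] TensorSmash k H V ⊗[k] TensorSmash k H V :=
  let T := TensorAlgebra k V
  smashComulAux k H V ∘ₗ
    TensorProduct.map ((Smash.ofTensor k H T T).symm.toLinearMap ∘ₗ
      (braidedComul k H V).toLinearMap) Coalgebra.comul ∘ₗ
    (Smash.ofTensor k H T H).symm.toLinearMap

/-- The braiding `c(x ⊗ y) = x₍₋₁₎ . y ⊗ x₍₀₎` of `TV`. -/
def braidMap : TensorAlgebra k V ⊗[k] TensorAlgebra k V →ₗ[k]
    TensorAlgebra k V ⊗[k] TensorAlgebra k V :=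
  let T := TensorAlgebra k V
  TensorProduct.lift <|
    (LinearMap.rTensorHom T ∘ₗ (ModuleAlgebra.act (k := k) (H := H) (A := T)).flip).flip ∘ₗ
      LeftComodule.coact (k := k) (H := H) (M := T)

/-- The map `x ⊗ y ↦ y₍₀₎ ⊗ S'(y₍₋₁₎) . x`, for a linear map `S' : H → H`. -/
def braidInvMap (S' : H →ₗ[k] H) : TensorAlgebra k V ⊗[k] TensorAlgebra k V →ₗ[k]
    TensorAlgebra k V ⊗[k] TensorAlgebra k V :=
  let T := TensorAlgebra k V
  TensorProduct.lift <|
    ((LinearMap.rTensorHom T ∘ₗ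
      (ModuleAlgebra.act (k := k) (H := H) (A := T) ∘ₗ S').flip).compr₂
        (TensorProduct.comm k T T).toLinearMap).compl₂
      (LeftComodule.coact (k := k) (H := H) (M := T))

variable {k H V}

/-- The inverse of the (bijective) antipode. -/
def antipodeInv (hS : Function.Bijective (HopfAlgebra.antipode k : H →ₗ[k] H)) : H →ₗ[k] H :=
  (LinearEquiv.ofBijective (HopfAlgebra.antipode k : H →ₗ[k] H) hS).symm.toLinearMap

theorem antipode_antipodeInv (hS : Function.Bijective (HopfAlgebra.antipode k : H →ₗ[k] H))
    (h : H) : HopfAlgebra.antipode k (antipodeInv hS h) = h :=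
  LinearEquiv.apply_symm_apply (LinearEquiv.ofBijective (HopfAlgebra.antipode k) hS) h

/-- `h₍₂₎ S⁻¹(h₍₁₎) = ε(h) 1`. -/
theorem mul_antipodeInv (hS : Function.Bijective (HopfAlgebra.antipode k : H →ₗ[k] H)) (h : H) :
    TensorProduct.lift ((LinearMap.mul k H).flip ∘ₗ antipodeInv hS) (Coalgebra.comul h) =
      algebraMap k H (Coalgebra.counit h) := by
  apply hS.injective
  have h1 := HopfAlgebra.mul_antipode_lTensor_comul_apply (R := k) h
  have h2 : ∀ t : H ⊗[k] H, HopfAlgebra.antipode k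
      (TensorProduct.lift ((LinearMap.mul k H).flip ∘ₗ antipodeInv hS) t) =
      LinearMap.mul' k H ((HopfAlgebra.antipode k).lTensor H t) := by
    intro t
    induction t with
    | zero => simp
    | add t t' ht ht' => simp only [map_add, ht, ht']
    | tmul a b => simp [HopfAlgebra.antipode_mul_antidistrib, antipode_antipodeInv]
  rw [h2, h1, Algebra.algebraMap_eq_smul_one, map_smul, HopfAlgebra.antipode_one]

/-- `S⁻¹(h₍₂₎) h₍₁₎ = ε(h) 1`. -/
theorem antipodeInv_mul (hS : Function.Bijective (HopfAlgebra.antipode k : H →ₗ[k] H)) (h : H) :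
    TensorProduct.lift ((LinearMap.mul k H).flip.compl₂ (antipodeInv hS)) (Coalgebra.comul h) =
      algebraMap k H (Coalgebra.counit h) := by
  apply hS.injective
  have h1 := HopfAlgebra.mul_antipode_rTensor_comul_apply (R := k) h
  have h2 : ∀ t : H ⊗[k] H, HopfAlgebra.antipode k
      (TensorProduct.lift ((LinearMap.mul k H).flip.compl₂ (antipodeInv hS)) t) =
      LinearMap.mul' k H ((HopfAlgebra.antipode k).rTensor H t) := by
    intro t
    induction t with
    | zero => simp
    | add t t' ht ht' => simp only [map_add, ht, ht']
    | tmul a b => simp [HopfAlgebra.antipode_mul_antidistrib, antipode_antipodeInv]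
  rw [h2, h1, Algebra.algebraMap_eq_smul_one, map_smul, HopfAlgebra.antipode_one]

theorem braidMap_braidInvMap (hS : Function.Bijective (HopfAlgebra.antipode k : H →ₗ[k] H)) :
    braidMap k H V ∘ₗ braidInvMap k H V (antipodeInv hS) = LinearMap.id := by
  let T := TensorAlgebra k V
  let act := ModuleAlgebra.act (k := k) (H := H) (A := T)
  ext x y
  change braidMap k H V (braidInvMap k H V (antipodeInv hS) (x ⊗ₜ y)) = x ⊗ₜ y
  let F : H ⊗[k] (H ⊗[k] T) →ₗ[k] T ⊗[k] T := TensorProduct.lift <|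
    (LinearMap.rTensorHom T ∘ₗ act.flip).comp ((act.flip x) ∘ₗ antipodeInv hS)
  have key := congrArg F (LeftComodule.coassoc (k := k) (H := H) y)
  have e1 : ∀ t : H ⊗[k] T, F ((LeftComodule.coact (k := k) (H := H) (M := T)).lTensor H t) =
      braidMap k H V (TensorProduct.comm k T T
        (((act ∘ₗ antipodeInv hS).flip x).rTensor T t)) := by
    intro t
    induction t with
    | zero => simp
    | add t t' ht ht' => simp only [map_add, ht, ht']
    | tmul g z => simp [F, braidMap, T, act]
  have e2 : ∀ t : H ⊗[k] T, F (TensorProduct.assoc k H H T (Coalgebra.comul.rTensor T t)) =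
      TensorProduct.lift (TensorProduct.mk k T T ∘ₗ LinearMap.toSpanSingleton k T x) (Coalgebra.counit.rTensor T t) := by
    intro t
    induction t with
    | zero => simp
    | add t t' ht ht' => simp only [map_add, ht, ht']
    | tmul g z =>
      have : ∀ s : H ⊗[k] H, F (TensorProduct.assoc k H H T (s ⊗ₜ z)) =
          act (TensorProduct.lift ((LinearMap.mul k H).flip ∘ₗ antipodeInv hS) s) x ⊗ₜ z := by
        intro s
        induction s with
        | zero => simp
        | add s s' hs hs' => simp only [map_add, TensorProduct.add_tmul, hs, hs',
            LinearMap.add_apply]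
        | tmul a b => simp [F, T, act, ModuleAlgebra.mul_act]
      rw [LinearMap.rTensor_tmul, this, mul_antipodeInv, Algebra.algebraMap_eq_smul_one]
      simp [act, ModuleAlgebra.one_act]
      rfl
  rw [e1, e2, LeftComodule.counit_coact] at key
  simpa [braidInvMap, act, T] using key.symm

theorem braidInvMap_braidMap (hS : Function.Bijective (HopfAlgebra.antipode k : H →ₗ[k] H)) :
    braidInvMap k H V (antipodeInv hS) ∘ₗ braidMap k H V = LinearMap.id := by
  let T := TensorAlgebra k V
  let act := ModuleAlgebra.act (k := k) (H := H) (A := T)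
  ext x y
  change braidInvMap k H V (antipodeInv hS) (braidMap k H V (x ⊗ₜ y)) = x ⊗ₜ y
  let F : H ⊗[k] (H ⊗[k] T) →ₗ[k] T ⊗[k] T := TensorProduct.lift <|
    ((LinearMap.rTensorHom T ∘ₗ (act ∘ₗ antipodeInv hS).flip).compr₂
      (TensorProduct.comm k T T).toLinearMap) ∘ₗ (act.flip y)
  have key := congrArg F (LeftComodule.coassoc (k := k) (H := H) x)
  have e1 : ∀ t : H ⊗[k] T, F ((LeftComodule.coact (k := k) (H := H) (M := T)).lTensor H t) =
      braidInvMap k H V (antipodeInv hS) ((act.flip y).rTensor T t) := by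
    intro t
    induction t with
    | zero => simp
    | add t t' ht ht' => simp only [map_add, ht, ht']
    | tmul g z => simp [F, braidInvMap, T, act]
  have e2 : ∀ t : H ⊗[k] T, F (TensorProduct.assoc k H H T (Coalgebra.comul.rTensor T t)) =
      TensorProduct.lift (LinearMap.flip (TensorProduct.mk k T T) ∘ₗ
        LinearMap.toSpanSingleton k T y) (Coalgebra.counit.rTensor T t) := by
    intro t
    induction t with
    | zero => simp
    | add t t' ht ht' => simp only [map_add, ht, ht']
    | tmul g z =>
      have : ∀ s : H ⊗[k] H, F (TensorProduct.assoc k H H T (s ⊗ₜ z)) = z ⊗ₜ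
          act (TensorProduct.lift ((LinearMap.mul k H).flip.compl₂ (antipodeInv hS)) s) y := by
        intro s
        induction s with
        | zero => simp
        | add s s' hs hs' => simp only [map_add, TensorProduct.add_tmul, TensorProduct.tmul_add,
            hs, hs', LinearMap.add_apply]
        | tmul a b => simp [F, T, act, ModuleAlgebra.mul_act]
      rw [LinearMap.rTensor_tmul, this, antipodeInv_mul, Algebra.algebraMap_eq_smul_one]
      simp [act, ModuleAlgebra.one_act]
  rw [e1, e2, LeftComodule.counit_coact] at key
  simpa [braidMap, act, T] using key.symm

variable (V)

/-- The braiding `c` of `TV` as a linear isomorphism (the antipode of `H` being bijective), with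
`c⁻¹(x ⊗ y) = y₍₀₎ ⊗ S⁻¹(y₍₋₁₎) . x`. -/
def braiding (hS : Function.Bijective (HopfAlgebra.antipode k : H →ₗ[k] H)) :
    TensorAlgebra k V ⊗[k] TensorAlgebra k V ≃ₗ[k] TensorAlgebra k V ⊗[k] TensorAlgebra k V :=
  LinearEquiv.ofLinearMap (braidMap k H V) (braidInvMap k H V (antipodeInv hS))
    (braidMap_braidInvMap hS) (braidInvMap_braidMap hS)

/-- The bracket `[x, y] = xy - m c⁻¹(x ⊗ y)`, as a linear map on `TV ⊗ TV`. -/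
def bracket (hS : Function.Bijective (HopfAlgebra.antipode k : H →ₗ[k] H)) :
    TensorAlgebra k V ⊗[k] TensorAlgebra k V →ₗ[k] TensorAlgebra k V :=
  LinearMap.mul' k (TensorAlgebra k V) -
    LinearMap.mul' k (TensorAlgebra k V) ∘ₗ (braiding V hS).symm.toLinearMap

variable {A : Type*} [LinearOrder A]

/-- The operation `x ↦ [x]` for `u`-vectors `x`, `u` a Lyndon word, as a linear map on `V^{⊗|u|}`:
`[x] = x` if `|u| ≤ 1`, and `[x] = [[x_v], [x_w]]` if `|u| ≥ 2` and `u = vw` is the Shirshov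
decomposition, where `x = x_v ⊗ x_w` under `V^{⊗|u|} ≃ V^{⊗|v|} ⊗ V^{⊗|w|}`. -/
def letterBracket (hS : Function.Bijective (HopfAlgebra.antipode k : H →ₗ[k] H)) (u : List A) :
    (⨂[k]^(u.length) V) →ₗ[k] TensorAlgebra k V :=
  if hu : u.length ≤ 1 then TensorPower.toTensorAlgebra
  else
    bracket V hS ∘ₗ
      TensorProduct.map (letterBracket hS (u.take (shirshovIndex u)))
        (letterBracket hS (u.drop (shirshovIndex u))) ∘ₗ
      TensorPower.mulEquiv.symm.toLinearMap ∘ₗ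
      (TensorPower.cast k V (by rw [← List.length_append, List.take_append_drop] :
        u.length = (u.take (shirshovIndex u)).length +
          (u.drop (shirshovIndex u)).length)).toLinearMap
termination_by u.length
decreasing_by
  · have := shirshovIndex_spec hu
    rw [List.length_take]; omega
  · have := shirshovIndex_spec hu
    rw [List.length_drop]; omega

/-- The operation `x ↦ [x]` for a super-word `w = v₁⋯vᵣ`, as a linear map on `V^{⊗|w|}`:
`[x] = [x_{v₁}]⋯[x_{vᵣ}]`. -/
def wordBracket (hS : Function.Bijective (HopfAlgebra.antipode k : H →ₗ[k] H)) :
    (w : List (List A)) → (⨂[k]^(w.flatten.length) V) →ₗ[k] TensorAlgebra k V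
  | [] => TensorPower.toTensorAlgebra
  | v :: w =>
    LinearMap.mul' k (TensorAlgebra k V) ∘ₗ
      TensorProduct.map (letterBracket V hS v) (wordBracket hS w) ∘ₗ
      TensorPower.mulEquiv.symm.toLinearMap ∘ₗ
      (TensorPower.cast k V (by rw [List.flatten_cons, List.length_append] :
        (v :: w).flatten.length = v.length + w.flatten.length)).toLinearMap

variable {V}

/-- The space `V^u = V_{a₁} ⊗ ⋯ ⊗ V_{aₘ} ⊆ V^{⊗m}` of `u`-vectors, for `u = a₁⋯aₘ`. -/
def wordSpace (Vc : A → Submodule k V) (u : List A) : Submodule k (⨂[k]^(u.length) V) :=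
  Submodule.span k {t | ∃ x : Fin u.length → V, (∀ i, x i ∈ Vc (u.get i)) ∧
    PiTensorProduct.tprod k x = t}

/-- `X` is a `u`-`[ ]`-letter. -/
def IsBracketLetter (hS : Function.Bijective (HopfAlgebra.antipode k : H →ₗ[k] H))
    (Vc : A → Submodule k V) (u : List A) (X : TensorAlgebra k V) : Prop :=
  IsLyndon u ∧ ∃ x ∈ wordSpace Vc u, letterBracket V hS u x = X

/-- `X` is a `w`-`[ ]`-word. -/
def IsBracketWord (hS : Function.Bijective (HopfAlgebra.antipode k : H →ₗ[k] H))
    (Vc : A → Submodule k V) (w : List (List A)) (X : TensorAlgebra k V) : Prop :=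
  IsMonotonic w ∧ ∃ x ∈ wordSpace Vc w.flatten, wordBracket V hS w x = X

variable (k V)

/-- `T⁺V = ⨁_{n ≥ 1} V^{⊗n}` as a subspace of `TV`. -/
def tensorPlus : Submodule k (TensorAlgebra k V) :=
  ⨆ n : ℕ, LinearMap.range (TensorAlgebra.ι k : V →ₗ[k] TensorAlgebra k V) ^ (n + 1)

end TensorAlg

end

end LyndonHopf

namespace LyndonHopf

noncomputable section

set_option linter.unusedSectionVars false

/-! ## The smash product as an algebra generated by its two factors -/

namespace Smash

section General

variable (k H A B : Type*) [Field k] [Ring H] [Bialgebra k H] [Ring A] [Algebra k A]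
  [Ring B] [Algebra k B] [ModuleAlgebra k H A] [ComoduleAlgebra k H B]

/-! The argument works with spaces of letters instead of single letters. If subspaces X and Y of TV
are stable under action and coaction, c maps Y ⊗ X onto X ⊗ Y. So the bracket of X ⊗ Y is spanned by
the elements m c(y ⊗ x) - y x (`braidedComm`, `commSub`), and c⁻¹ disappears. Writing L(u) for the
space of u-letters, L(u) = [L(v), L(w)] for the Shirshov decomposition u = vw
(`letterSpace_eq_commSub`), and the words attached to a fixed super-word form a product of such
spaces (`map_wordBracket`).

By the Yetter-Drinfeld condition c is H-linear and H-colinear on TV (`tensorAlgebra_isYDAlgebra`),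
so the braided commutator satisfies a Jacobi identity besides its Leibniz rules. They give a
straightening result (`commSub_le_superSpan`): for Lyndon words v < w, [L(v), L(w)] lies in the span
of the monotonic words in letters ≥ vw. Consequently the monotonic words in letters from an upward
closed set span a nonunital subalgebra (`superSpan_mul_self_le`).

Let D(x) = Δ_{TV}(x) - x ⊗ 1 - 1 ⊗ x. Induction on |u| shows that D maps L(u) into K(u) ⊗ T⁺V, where
K(u) is spanned by the monotonic words whose letters z satisfy ua < z for every word a (`ExtLT`).
This is stronger than z > u, and the induction needs it, since z > v alone does not give z > vw. For
a in L(v) and b in L(w), expand D(m c(b ⊗ a) - ba) in the braided tensor square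
(`reducedComul_braidedComm_mem`). The term c(b ⊗ a) cancels against (1 ⊗ b)(a ⊗ 1). The terms with a
free factor a on the left combine to a braided commutator of a with D(b), whose left leg lies in
[L(v), K(w)] ⊆ K(u) (`commSub_superSpan_extLT_le`). Every other term has its left leg in the algebra
K(u), which contains L(w) because w is a proper suffix of u.

Finally r ⊗ s ↦ (r # s₍₋₁₎) ⊗ (s₍₀₎ # 1) (`bosonize`) carries Δ_{TV}(X) to the coproduct of X in the
smash product. It sends 1 ⊗ X to X₍₋₁₎ ⊗ X₍₀₎ and keeps right legs in the stable subspace T⁺V. -/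

theorem mul_def (x y : Smash k H A B) : x * y = mulMap k H A B x y := rfl

theorem ofTensor_mul_ofTensor (a a' : A) (b b' : B) :
    ofTensor k H A B (a ⊗ₜ b) * ofTensor k H A B (a' ⊗ₜ b') =
      ofTensor k H A B (mulLeftFactor k A B a (mulRightFactor k H A B b (a' ⊗ₜ b'))) := by
  rw [mul_def]
  change mulMap k H A B (a ⊗ₜ b) (a' ⊗ₜ b') = _
  rw [mulMap_tmul]
  rfl

theorem mulRightFactor_apply (b : B) (a' : A) (b' : B) :
    mulRightFactor k H A B b (a' ⊗ₜ b') =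
      TensorProduct.map ((ModuleAlgebra.act (k := k) (H := H) (A := A)).flip a')
        ((LinearMap.mul k B).flip b') (LeftComodule.coact (k := k) (H := H) b) := by
  simp only [mulRightFactor, LinearMap.comp_apply]
  generalize LeftComodule.coact (k := k) (H := H) b = t
  induction t with
  | zero => simp
  | add t t' ht ht' => simp [ht, ht']
  | tmul g f => simp

theorem mulRightFactor_one (x : A ⊗[k] B) : mulRightFactor k H A B 1 x = x := by
  have h := LinearMap.congr_fun (mulMap_one k H A B) x
  have h1 : mulLeftFactor k A B 1 = 1 := by ext; simp [mulLeftFactor]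
  rwa [mulMap_tmul, h1, one_mul] at h

/-- The embedding `A → A # B` as a morphism of algebras. -/
def inlHom : A →ₐ[k] Smash k H A B :=
  AlgHom.ofLinearMap (inl k H A B) rfl fun a a' => by
    change ofTensor k H A B ((a * a') ⊗ₜ 1) =
      ofTensor k H A B (a ⊗ₜ 1) * ofTensor k H A B (a' ⊗ₜ 1)
    rw [ofTensor_mul_ofTensor, mulRightFactor_one]
    simp [mulLeftFactor]

/-- The embedding `B → A # B` as a morphism of algebras. -/
def inrHom : B →ₐ[k] Smash k H A B :=
  AlgHom.ofLinearMap (inr k H A B) rfl fun b b' => by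
    change ofTensor k H A B (1 ⊗ₜ (b * b')) =
      ofTensor k H A B (1 ⊗ₜ b) * ofTensor k H A B (1 ⊗ₜ b')
    rw [ofTensor_mul_ofTensor, mulRightFactor_apply]
    have h1 : ∀ t : H ⊗[k] B, TensorProduct.map
        ((ModuleAlgebra.act (k := k) (H := H) (A := A)).flip 1) ((LinearMap.mul k B).flip b') t =
        (Algebra.linearMap k A).rTensor B
          (((LinearMap.mul k B).flip b').lTensor k (Coalgebra.counit.rTensor B t)) := by
      intro t
      induction t with
      | zero => simp
      | add t t' ht ht' => simp [ht, ht']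
      | tmul g f => simp [ModuleAlgebra.act_one]
    rw [h1, LeftComodule.counit_coact]
    simp [mulLeftFactor]

variable {k H A B}

theorem inrHom_apply (b : B) : inrHom k H A B b = inr k H A B b := rfl

theorem inlHom_mul_inrHom (a : A) (b : B) :
    inlHom k H A B a * inrHom k H A B b = ofTensor k H A B (a ⊗ₜ b) := by
  change ofTensor k H A B (a ⊗ₜ 1) * ofTensor k H A B (1 ⊗ₜ b) = _
  rw [ofTensor_mul_ofTensor, mulRightFactor_one]
  simp [mulLeftFactor]

/-- `(1 ⊗ b)(a ⊗ 1) = b₍₋₁₎ . a ⊗ b₍₀₎`. -/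
theorem inrHom_mul_inlHom (a : A) (b : B) :
    inrHom k H A B b * inlHom k H A B a =
      ofTensor k H A B (((ModuleAlgebra.act (k := k) (H := H) (A := A)).flip a).rTensor B
        (LeftComodule.coact (k := k) (H := H) b)) := by
  change ofTensor k H A B (1 ⊗ₜ b) * ofTensor k H A B (a ⊗ₜ 1) = _
  rw [ofTensor_mul_ofTensor, mulRightFactor_apply]
  have : (LinearMap.mul k B).flip 1 = LinearMap.id := by ext; simp
  rw [this]
  have : mulLeftFactor k A B 1 = 1 := by ext; simp [mulLeftFactor]
  rw [this]
  rfl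

@[elab_as_elim]
theorem induction_on {p : Smash k H A B → Prop} (s : Smash k H A B) (zero : p 0)
    (add : ∀ s t, p s → p t → p (s + t))
    (mk : ∀ a b, p (inlHom k H A B a * inrHom k H A B b)) : p s :=
  TensorProduct.induction_on (motive := p) ((ofTensor k H A B).symm s) zero
    (fun a b => by
      have h := mk a b
      rw [inlHom_mul_inrHom] at h
      exact h) add

variable {C : Type*} [Ring C] [Algebra k C]

/-- The linear map `a ⊗ b ↦ f a * g b`. -/
def prodMap (f : A →ₐ[k] C) (g : B →ₐ[k] C) : Smash k H A B →ₗ[k] C :=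
  TensorProduct.lift ((LinearMap.mul k C).compl₁₂ f.toLinearMap g.toLinearMap) ∘ₗ
    (ofTensor k H A B).symm.toLinearMap

theorem prodMap_mul (f : A →ₐ[k] C) (g : B →ₐ[k] C) (a : A) (b : B) :
    prodMap (H := H) f g (inlHom k H A B a * inrHom k H A B b) = f a * g b := by
  rw [inlHom_mul_inrHom]
  simp [prodMap]

theorem prodMap_inl (f : A →ₐ[k] C) (g : B →ₐ[k] C) (a : A) :
    prodMap (H := H) f g (inlHom k H A B a) = f a := by
  have := prodMap_mul (H := H) f g a 1
  rwa [map_one, map_one, mul_one, mul_one] at this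

theorem prodMap_inr (f : A →ₐ[k] C) (g : B →ₐ[k] C) (b : B) :
    prodMap (H := H) f g (inrHom k H A B b) = g b := by
  have := prodMap_mul (H := H) f g 1 b
  rwa [map_one, map_one, one_mul, one_mul] at this

theorem prodMap_inl_mul (f : A →ₐ[k] C) (g : B →ₐ[k] C) (a : A) (s : Smash k H A B) :
    prodMap f g (inlHom k H A B a * s) = f a * prodMap f g s := by
  induction s using induction_on with
  | zero => simp
  | add s t hs ht => simp only [mul_add, map_add, hs, ht]
  | mk x y => rw [← mul_assoc, ← map_mul, prodMap_mul, prodMap_mul, map_mul, mul_assoc]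

theorem prodMap_mul_inr (f : A →ₐ[k] C) (g : B →ₐ[k] C) (b : B) (s : Smash k H A B) :
    prodMap f g (s * inrHom k H A B b) = prodMap f g s * g b := by
  induction s using induction_on with
  | zero => simp
  | add s t hs ht => simp only [add_mul, map_add, hs, ht]
  | mk x y => rw [mul_assoc, ← map_mul, prodMap_mul, prodMap_mul, map_mul, mul_assoc]

/-- Right multiplication by B is respected by `prodMap` in any case, so multiplicativity hinges only
on moving g b past the elements f a. -/
theorem prodMap_inr_mul {f : A →ₐ[k] C} {g : B →ₐ[k] C} {b : B}
    (h : ∀ a, g b * f a = prodMap f g (inrHom k H A B b * inlHom k H A B a))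
    (s : Smash k H A B) : prodMap f g (inrHom k H A B b * s) = g b * prodMap f g s := by
  induction s using induction_on with
  | zero => simp
  | add s t hs ht => simp only [mul_add, map_add, hs, ht]
  | mk x y => rw [← mul_assoc, prodMap_mul_inr, ← h, prodMap_mul, mul_assoc]

/-- Two algebra maps satisfying the commutation rule of the smash product induce an algebra map. -/
def lift (f : A →ₐ[k] C) (g : B →ₐ[k] C)
    (h : ∀ b a, g b * f a = prodMap f g (inrHom k H A B b * inlHom k H A B a)) :
    Smash k H A B →ₐ[k] C :=
  AlgHom.ofLinearMap (prodMap f g)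
    (by rw [← map_one (inlHom k H A B), prodMap_inl, map_one]) fun s t => by
      induction s using induction_on with
      | zero => simp
      | add s s' hs hs' => simp only [add_mul, map_add, hs, hs']
      | mk x y => rw [mul_assoc, prodMap_inl_mul, prodMap_inr_mul (h y), prodMap_mul, mul_assoc]

end General

end Smash

/-! ### Reduction of commutation rules on the tensor algebra to degree one. -/

section TensorReduction

variable {k H V : Type*} [Field k] [Ring H] [HopfAlgebra k H] [AddCommGroup V] [Module k V]
  [Module H V] [IsScalarTower k H V] [YetterDrinfeldModule k H V]

local notation "T" => TensorAlgebra k V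

/-- It suffices to check the commutation rule of the braided tensor square on generators. -/
theorem prodMap_commutation_of_ι {C : Type*} [Ring C] [Algebra k C] (f g : T →ₐ[k] C)
    (h : ∀ v w : V, g (TensorAlgebra.ι k v) * f (TensorAlgebra.ι k w) =
      Smash.prodMap f g (Smash.inrHom k H T T (TensorAlgebra.ι k v) *
        Smash.inlHom k H T T (TensorAlgebra.ι k w))) (b a : T) :
    g b * f a = Smash.prodMap f g (Smash.inrHom k H T T b * Smash.inlHom k H T T a) := by
  induction b using TensorAlgebra.induction generalizing a with
  | algebraMap r =>
    rw [AlgHom.commutes, AlgHom.commutes, ← Algebra.smul_def, ← Algebra.smul_def, map_smul,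
      Smash.prodMap_inl]
  | add x y hx hy => simp only [map_add, add_mul, hx, hy]
  | mul x y hx hy =>
    rw [map_mul g, map_mul (Smash.inrHom k H T T), mul_assoc, mul_assoc,
      Smash.prodMap_inr_mul (fun a => hx a), ← hy]
  | ι v =>
    -- Passing v over a replaces v by vectors v₍₀₎, again in V. Hence the rule for a' is assumed for
    -- all vectors at once, and the induction on a below generalizes v.
    have step : ∀ a' : T, (∀ v : V, g (TensorAlgebra.ι k v) * f a' =
        Smash.prodMap f g (Smash.inrHom k H T T (TensorAlgebra.ι k v) *
          Smash.inlHom k H T T a')) → ∀ (v : V) (a : T),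
        Smash.prodMap f g (Smash.inrHom k H T T (TensorAlgebra.ι k v) *
          Smash.inlHom k H T T a * Smash.inlHom k H T T a') =
        Smash.prodMap f g (Smash.inrHom k H T T (TensorAlgebra.ι k v) *
          Smash.inlHom k H T T a) * f a' := by
      intro a' ha' v a
      rw [Smash.inrHom_mul_inlHom]
      have : LeftComodule.coact (k := k) (H := H) (TensorAlgebra.ι k v) =
        (TensorAlgebra.ι k).lTensor H (LeftComodule.coact v) := tensorCoactHom_ι v
      rw [this]
      generalize LeftComodule.coact (k := k) (H := H) v = t
      induction t with
      | zero => simp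
      | add t t' ht ht' => simp only [map_add, add_mul, ht, ht']
      | tmul g' v' =>
        rw [LinearMap.lTensor_tmul, LinearMap.rTensor_tmul, ← Smash.inlHom_mul_inrHom, mul_assoc,
          Smash.prodMap_inl_mul, ← ha', Smash.prodMap_mul, mul_assoc]
    induction a using TensorAlgebra.induction generalizing v with
    | algebraMap r =>
      rw [AlgHom.commutes, AlgHom.commutes, ← Algebra.commutes, ← Algebra.commutes,
        ← Algebra.smul_def, ← Algebra.smul_def, map_smul, Smash.prodMap_inr]
    | add x y hx hy => simp only [map_add, mul_add, hx, hy]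
    | ι w => exact h v w
    | mul x y hx hy =>
      rw [map_mul f, map_mul (Smash.inlHom k H T T), ← mul_assoc, ← mul_assoc, step y hy, ← hx]

end TensorReduction

/-! ## Braided tensor squares of Yetter-Drinfeld algebras -/

section YDAlgebra

variable (k H A : Type*) [Field k] [Ring H] [Bialgebra k H] [Ring A] [Algebra k A]
  [ModuleAlgebra k H A] [ComoduleAlgebra k H A]

/-- The coaction of a comodule algebra as a morphism of algebras. -/
def coactHom : A →ₐ[k] H ⊗[k] A :=
  AlgHom.ofLinearMap LeftComodule.coact ComoduleAlgebra.coact_one ComoduleAlgebra.coact_mul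

/-- `a ↦ a₍₋₁₎ ⊗ (a₍₀₎ ⊗ 1)`. -/
def coactLeft : A →ₐ[k] H ⊗[k] Smash k H A A :=
  (Algebra.TensorProduct.map (AlgHom.id k H) (Smash.inlHom k H A A)).comp (coactHom k H A)

/-- `a ↦ a₍₋₁₎ ⊗ (1 ⊗ a₍₀₎)`. -/
def coactRight : A →ₐ[k] H ⊗[k] Smash k H A A :=
  (Algebra.TensorProduct.map (AlgHom.id k H) (Smash.inrHom k H A A)).comp (coactHom k H A)

/-- The diagonal coaction on the braided tensor square. -/
def diagCoact : Smash k H A A →ₗ[k] H ⊗[k] Smash k H A A :=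
  Smash.prodMap (coactLeft k H A) (coactRight k H A)

/-- The action of `H` on `A` as a morphism from `A` to the convolution algebra `Hom(H, A)`. -/
def actHom : A →ₐ[k] WithConv (H →ₗ[k] A) :=
  AlgHom.ofLinearMap ((WithConv.linearEquiv k (H →ₗ[k] A)).symm.toLinearMap ∘ₗ
      (ModuleAlgebra.act (k := k) (H := H) (A := A)).flip)
    (by ext h; simp [ModuleAlgebra.act_one])
    (fun a b => by ext h; simp [ModuleAlgebra.act_mul])

/-- Composition with a morphism of algebras, as a morphism of convolution algebras. -/
def convMap {A B : Type*} [Ring A] [Algebra k A] [Ring B] [Algebra k B] (f : A →ₐ[k] B) :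
    WithConv (H →ₗ[k] A) →ₐ[k] WithConv (H →ₗ[k] B) :=
  AlgHom.ofLinearMap ((WithConv.linearEquiv k (H →ₗ[k] B)).symm.toLinearMap ∘ₗ
      f.toLinearMap.compRight k (R := k) ∘ₗ (WithConv.linearEquiv k (H →ₗ[k] A)).toLinearMap)
    (by ext h; simp)
    (fun x y => by
      ext h
      simp only [LinearMap.comp_apply, LinearEquiv.coe_coe, WithConv.linearEquiv_apply,
        WithConv.symm_linearEquiv_apply, LinearMap.compRight_apply, LinearMap.convMul_apply,
        WithConv.ofConv_toConv, AlgHom.toLinearMap_apply]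
      generalize Coalgebra.comul (R := k) h = t
      induction t with
      | zero => simp
      | add t t' ht ht' => simp only [map_add, ht, ht']
      | tmul a b => simp)

/-- `a ↦ (h ↦ h . a ⊗ 1)`. -/
def actLeft : A →ₐ[k] WithConv (H →ₗ[k] Smash k H A A) :=
  (convMap k H (Smash.inlHom k H A A)).comp (actHom k H A)

/-- `a ↦ (h ↦ 1 ⊗ h . a)`. -/
def actRight : A →ₐ[k] WithConv (H →ₗ[k] Smash k H A A) :=
  (convMap k H (Smash.inrHom k H A A)).comp (actHom k H A)

/-- The diagonal action on the braided tensor square. -/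
def diagAct : Smash k H A A →ₗ[k] WithConv (H →ₗ[k] Smash k H A A) :=
  Smash.prodMap (actLeft k H A) (actRight k H A)

/-- The braiding of `A` with itself is linear and colinear over `H`. -/
class IsYDAlgebra : Prop where
  coact_mul : ∀ b a : A, coactRight k H A b * coactLeft k H A a =
    diagCoact k H A (Smash.inrHom k H A A b * Smash.inlHom k H A A a)
  act_mul : ∀ b a : A, actRight k H A b * actLeft k H A a =
    diagAct k H A (Smash.inrHom k H A A b * Smash.inlHom k H A A a)

variable {k H A}

theorem actLeft_apply (a : A) (h : H) :
    (actLeft k H A a).ofConv h =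
    Smash.inlHom k H A A (ModuleAlgebra.act (k := k) h a) := rfl

theorem actRight_apply (a : A) (h : H) :
    (actRight k H A a).ofConv h =
    Smash.inrHom k H A A (ModuleAlgebra.act (k := k) h a) := rfl

theorem coactLeft_apply (a : A) : coactLeft k H A a =
    (Smash.inlHom k H A A).toLinearMap.lTensor H (LeftComodule.coact a) := rfl

theorem coactRight_apply (a : A) : coactRight k H A a =
    (Smash.inrHom k H A A).toLinearMap.lTensor H (LeftComodule.coact a) := rfl

variable (k H A) in
/-- The diagonal coaction on the braided tensor square as a morphism of algebras. -/
def diagCoactHom [IsYDAlgebra k H A] : Smash k H A A →ₐ[k] H ⊗[k] Smash k H A A :=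
  Smash.lift (coactLeft k H A) (coactRight k H A) IsYDAlgebra.coact_mul

end YDAlgebra

/-! ## The tensor algebra is a Yetter-Drinfeld algebra -/

section TensorYD

variable {k H V : Type*} [Field k] [Ring H] [HopfAlgebra k H] [AddCommGroup V] [Module k V]
  [Module H V] [IsScalarTower k H V] [YetterDrinfeldModule k H V]

local notation "T" => TensorAlgebra k V
local notation "ι'" => TensorAlgebra.ι k

variable (k H) in
/-- `(h, h') ↦ (h . v)₍₋₁₎ h' ⊗ (h . v)₍₀₎`. -/
def coactSMulRight (v : V) : H →ₗ[k] H →ₗ[k] H ⊗[k] V :=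
  (LinearMap.rTensorHom V ∘ₗ (LinearMap.mul k H).flip).flip ∘ₗ
    LeftComodule.coact (k := k) (H := H) ∘ₗ (Algebra.lsmul k k V).toLinearMap.flip v

theorem coactSMulRight_apply (v : V) (h h' : H) : coactSMulRight k H v h h' =
    ((LinearMap.mul k H).flip h').rTensor V (LeftComodule.coact (k := k) (h • v)) := rfl

variable (k H V) in
/-- `(g ⊗ h, x ⊗ v) ↦ g x ⊗ h . v`. -/
def tensorSMul : H ⊗[k] H →ₗ[k] H ⊗[k] V →ₗ[k] H ⊗[k] V :=
  TensorProduct.map₂ (LinearMap.mul k H) (Algebra.lsmul k k V).toLinearMap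

theorem tensorSMul_tmul (g h x : H) (v : V) :
    tensorSMul k H V (g ⊗ₜ h) (x ⊗ₜ v) = (g * x) ⊗ₜ (h • v) := rfl

/-- The Yetter-Drinfeld condition `(h₍₁₎ . v)₍₋₁₎ h₍₂₎ ⊗ (h₍₁₎ . v)₍₀₎ = h₍₁₎ v₍₋₁₎ ⊗ h₍₂₎ . v₍₀₎`. -/
theorem lift_coactSMulRight_comul (h : H) (v : V) :
    TensorProduct.lift (coactSMulRight k H v) (Coalgebra.comul h) =
      tensorSMul k H V (Coalgebra.comul h) (LeftComodule.coact v) := by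
  set t : H ⊗[k] V := LeftComodule.coact v with ht
  let Φ : ((H ⊗[k] H) ⊗[k] H) ⊗[k] H →ₗ[k] H ⊗[k] V :=
    TensorProduct.lift ((LinearMap.rTensorHom V ∘ₗ (LinearMap.mul k H).flip).flip ∘ₗ
      ydTwist k H V t)
  have hΦ : ∀ (p : H ⊗[k] H) (x y : H), Φ ((p ⊗ₜ x) ⊗ₜ y) =
      ((LinearMap.mul k H).flip (HopfAlgebra.antipode k x * y)).rTensor V
        (tensorSMul k H V p t) := by
    intro p x y
    change ((LinearMap.mul k H).flip y).rTensor V (((LinearMap.mul k H).flip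
      (HopfAlgebra.antipode k x)).rTensor V (tensorSMul k H V p t)) = _
    rw [← LinearMap.comp_apply, ← LinearMap.rTensor_comp]
    congr 2
    ext z
    simp [mul_assoc]
  have h1 : ∀ s : H ⊗[k] H, TensorProduct.lift (coactSMulRight k H v) s =
      Φ ((Coalgebra.comul.rTensor H).rTensor H (Coalgebra.comul.rTensor H s)) := by
    intro s
    induction s with
    | zero => simp
    | add s s' hs hs' => simp only [map_add, hs, hs']
    | tmul a b =>
      rw [TensorProduct.lift.tmul, coactSMulRight_apply, YetterDrinfeldModule.coact_smul]
      rfl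
  rw [h1, ← Coalgebra.coassoc_symm_apply]
  -- After coassociativity the factor S(h₍₃₎) coming from `ydTwist` stands next to the extra h₍₄₎,
  -- and S(h₍₃₎)h₍₄₎ collapses to a counit.
  have h2 : ∀ s : H ⊗[k] H, Φ ((Coalgebra.comul.rTensor H).rTensor H
      ((TensorProduct.assoc k H H H).symm (Coalgebra.comul.lTensor H s))) =
      tensorSMul k H V (Coalgebra.comul
        (TensorProduct.rid k H (Coalgebra.counit.lTensor H s))) t := by
    intro s
    induction s with
    | zero => simp
    | add s s' hs hs' => simp only [map_add, hs, hs', LinearMap.add_apply]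
    | tmul a b =>
      have h3 : ∀ q : H ⊗[k] H, Φ ((Coalgebra.comul.rTensor H).rTensor H
          ((TensorProduct.assoc k H H H).symm (a ⊗ₜ q))) =
          ((LinearMap.mul k H).flip (LinearMap.mul' k H
            ((HopfAlgebra.antipode k).rTensor H q))).rTensor V
            (tensorSMul k H V (Coalgebra.comul a) t) := by
        intro q
        induction q with
        | zero => simp
        | add s s' hs hs' =>
          simp only [map_add, TensorProduct.tmul_add, hs, hs', LinearMap.rTensor_add,
            LinearMap.add_apply]
        | tmul x y =>
          rw [TensorProduct.assoc_symm_tmul, LinearMap.rTensor_tmul, LinearMap.rTensor_tmul, hΦ]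
          rfl
      rw [LinearMap.lTensor_tmul, h3, HopfAlgebra.mul_antipode_rTensor_comul_apply,
        LinearMap.lTensor_tmul, TensorProduct.rid_tmul, map_smul, map_smul, LinearMap.smul_apply,
        Algebra.algebraMap_eq_smul_one, map_smul, LinearMap.rTensor_smul, LinearMap.smul_apply]
      have : (LinearMap.mul k H).flip 1 = LinearMap.id := by ext; simp
      rw [this, LinearMap.rTensor_id_apply]
  rw [h2, Coalgebra.lTensor_counit_comul, TensorProduct.rid_tmul, one_smul]

theorem coact_ι (v : V) : LeftComodule.coact (k := k) (H := H) (ι' v) =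
    (TensorAlgebra.ι k).lTensor H (LeftComodule.coact v) := tensorCoactHom_ι v

theorem act_ι (h : H) (v : V) : ModuleAlgebra.act (k := k) h (ι' v) = ι' (h • v) :=
  tensorActHom_ι v h

/-- `h ⊗ v ↦ (h . w) ⊗ v` -/
def inlSMulInr (w : V) : H ⊗[k] V →ₗ[k] Smash k H T T :=
  (Smash.ofTensor k H T T).toLinearMap ∘ₗ TensorProduct.map
    (TensorAlgebra.ι k ∘ₗ (Algebra.lsmul k k V).toLinearMap.flip w) (TensorAlgebra.ι k)

theorem inlSMulInr_tmul (w v : V) (h : H) : inlSMulInr w (h ⊗ₜ[k] v) =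
    Smash.inlHom k H T T (ι' (h • w)) * Smash.inrHom k H T T (ι' v) := by
  rw [Smash.inlHom_mul_inrHom]
  rfl

theorem inrHom_ι_mul_inlHom_ι (v w : V) :
    Smash.inrHom k H T T (ι' v) * Smash.inlHom k H T T (ι' w) =
      inlSMulInr w (LeftComodule.coact v) := by
  rw [Smash.inrHom_mul_inlHom, coact_ι]
  generalize LeftComodule.coact (k := k) (H := H) v = t
  induction t with
  | zero => simp
  | add s s' hs hs' => simp only [map_add, hs, hs']
  | tmul a b =>
    rw [LinearMap.lTensor_tmul, LinearMap.rTensor_tmul, LinearMap.flip_apply, act_ι]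
    rfl

/-- H-linearity of c on V ⊗ V. Evaluated at h, the left side is (h₍₁₎ . v)₍₋₁₎ h₍₂₎ . w ⊗ (h₍₁₎ .
v)₍₀₎ and the right side is h₍₁₎ v₍₋₁₎ . w ⊗ h₍₂₎ . v₍₀₎; these agree by the antipode-free form of
the Yetter-Drinfeld condition. -/
theorem actRight_ι_mul_actLeft_ι (v w : V) :
    actRight k H T (ι' v) * actLeft k H T (ι' w) =
      diagAct k H T (Smash.inrHom k H T T (ι' v) * Smash.inlHom k H T T (ι' w)) := by
  ext h
  have e1 : ∀ t : H ⊗[k] V, (diagAct k H T (inlSMulInr w t)).ofConv h =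
      inlSMulInr w (tensorSMul k H V (Coalgebra.comul h) t) := by
    intro t
    induction t with
    | zero => simp
    | add s s' hs hs' => simp only [map_add, hs, hs', WithConv.ofConv_add, LinearMap.add_apply]
    | tmul x v' =>
      rw [inlSMulInr_tmul, diagAct, Smash.prodMap_mul, LinearMap.convMul_apply]
      generalize Coalgebra.comul (R := k) h = s
      induction s with
      | zero => simp
      | add s s' hs hs' => simp only [map_add, hs, hs', LinearMap.add_apply]
      | tmul a b =>
        rw [TensorProduct.map_tmul, LinearMap.mul'_apply, actLeft_apply, actRight_apply, act_ι,
          act_ι, tensorSMul_tmul, inlSMulInr_tmul, mul_smul]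
  rw [inrHom_ι_mul_inlHom_ι, e1, ← lift_coactSMulRight_comul, LinearMap.convMul_apply]
  generalize Coalgebra.comul (R := k) h = s
  induction s with
  | zero => simp
  | add s s' hs hs' => simp only [map_add, hs, hs']
  | tmul a b =>
    rw [TensorProduct.map_tmul, LinearMap.mul'_apply, actLeft_apply, actRight_apply, act_ι,
      act_ι, inrHom_ι_mul_inlHom_ι, TensorProduct.lift.tmul, coactSMulRight_apply]
    generalize LeftComodule.coact (k := k) (H := H) (a • v) = t
    induction t with
    | zero => simp
    | add s s' hs hs' => simp only [map_add, hs, hs']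
    | tmul x v' =>
      rw [LinearMap.rTensor_tmul, inlSMulInr_tmul, inlSMulInr_tmul, LinearMap.flip_apply,
        LinearMap.mul_apply', mul_smul]

/-- H-colinearity of c on V ⊗ V. The left side is v₍₋₂₎ w₍₋₁₎ ⊗ (v₍₋₁₎ . w₍₀₎ ⊗ v₍₀₎), encoded by
`Q`. The right side is (v₍₋₂₎ . w)₍₋₁₎ v₍₋₁₎ ⊗ ((v₍₋₂₎ . w)₍₀₎ ⊗ v₍₀₎), encoded by `R`. -/
theorem coactRight_ι_mul_coactLeft_ι (v w : V) :
    coactRight k H T (ι' v) * coactLeft k H T (ι' w) =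
      diagCoact k H T (Smash.inrHom k H T T (ι' v) * Smash.inlHom k H T T (ι' w)) := by
  let N : H ⊗[k] V →ₗ[k] H ⊗[k] Smash k H T T :=
    ((Smash.inlHom k H T T).toLinearMap ∘ₗ TensorAlgebra.ι k).lTensor H
  have hN : coactLeft k H T (ι' w) = N (LeftComodule.coact w) := by
    rw [coactLeft_apply, coact_ι, ← LinearMap.comp_apply, ← LinearMap.lTensor_comp]
  let M : H ⊗[k] V →ₗ[k] V →ₗ[k] H ⊗[k] Smash k H T T :=
    (LinearMap.mul k (H ⊗[k] Smash k H T T)).compl₁₂ N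
      (TensorProduct.mk k H _ 1 ∘ₗ (Smash.inrHom k H T T).toLinearMap ∘ₗ TensorAlgebra.ι k)
  have hM : ∀ (y : H ⊗[k] V) (v' : V), M y v' =
      N y * (1 ⊗ₜ Smash.inrHom k H T T (ι' v')) := fun _ _ => rfl
  let Q : H ⊗[k] (H ⊗[k] V) →ₗ[k] H ⊗[k] Smash k H T T :=
    TensorProduct.lift (M ∘ₗ (tensorSMul k H V).flip (LeftComodule.coact w)) ∘ₗ
      (TensorProduct.assoc k H H V).symm.toLinearMap
  have hQ : ∀ (g h : H) (v' : V), Q (g ⊗ₜ (h ⊗ₜ v')) =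
      N (tensorSMul k H V (g ⊗ₜ h) (LeftComodule.coact w)) *
        (1 ⊗ₜ Smash.inrHom k H T T (ι' v')) := fun _ _ _ => rfl
  let R : H ⊗[k] (H ⊗[k] V) →ₗ[k] H ⊗[k] Smash k H T T :=
    TensorProduct.lift (M ∘ₗ TensorProduct.lift (coactSMulRight k H w)) ∘ₗ
      (TensorProduct.assoc k H H V).symm.toLinearMap
  have hR : ∀ (g h : H) (v' : V), R (g ⊗ₜ (h ⊗ₜ v')) =
      N (coactSMulRight k H w g h) * (1 ⊗ₜ Smash.inrHom k H T T (ι' v')) := fun _ _ _ => rfl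
  -- Coassociativity turns v₍₋₂₎ ⊗ v₍₋₁₎ into the coproduct of one element of H, where the
  -- Yetter-Drinfeld condition identifies `Q` with `R`.
  have hQR : Q (LeftComodule.coact.lTensor H (LeftComodule.coact v)) =
      R (LeftComodule.coact.lTensor H (LeftComodule.coact v)) := by
    rw [← LeftComodule.coassoc]
    generalize LeftComodule.coact (k := k) (H := H) v = t
    induction t with
    | zero => simp
    | add s s' hs hs' => simp only [map_add, hs, hs']
    | tmul x v' =>
      simp only [Q, R, LinearMap.comp_apply, LinearMap.rTensor_tmul, LinearEquiv.coe_coe,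
        LinearEquiv.symm_apply_apply, TensorProduct.lift.tmul, lift_coactSMulRight_comul,
        LinearMap.flip_apply]
  have hQ' : coactRight k H T (ι' v) * coactLeft k H T (ι' w) =
      Q (LeftComodule.coact.lTensor H (LeftComodule.coact v)) := by
    rw [hN, coactRight_apply, coact_ι]
    generalize LeftComodule.coact (k := k) (H := H) v = t
    induction t with
    | zero => simp
    | add s s' hs hs' => simp only [map_add, hs, hs', add_mul]
    | tmul g v' =>
      rw [LinearMap.lTensor_tmul, LinearMap.lTensor_tmul, LinearMap.lTensor_tmul]
      let Q' : H ⊗[k] V → H ⊗[k] V → H ⊗[k] Smash k H T T := fun s p =>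
        TensorProduct.lift (M ∘ₗ (tensorSMul k H V).flip s)
          ((TensorProduct.assoc k H H V).symm (g ⊗ₜ p))
      have hQ'z : ∀ p, Q' 0 p = 0 := by
        intro p
        simp only [Q', map_zero, LinearMap.comp_zero]
        exact LinearMap.congr_fun (map_zero
          (TensorProduct.uncurry (.id k) (H ⊗[k] H) V (H ⊗[k] Smash k H T T))) _
      have hQ'a : ∀ s s' p, Q' (s + s') p = Q' s p + Q' s' p := by
        intro s s' p
        simp only [Q', map_add, LinearMap.comp_add]
        exact LinearMap.congr_fun (map_add
          (TensorProduct.uncurry (.id k) (H ⊗[k] H) V (H ⊗[k] Smash k H T T)) _ _) _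
      have e : ∀ s : H ⊗[k] V, (g ⊗ₜ (Smash.inrHom k H T T).toLinearMap (ι' v')) * N s =
          Q' s (LeftComodule.coact v') := by
        intro s
        induction s with
        | zero => rw [map_zero, mul_zero, hQ'z]
        | add s s' hs hs' => rw [map_add, mul_add, hs, hs', hQ'a]
        | tmul x w' =>
          simp only [N, LinearMap.lTensor_tmul, LinearMap.comp_apply, AlgHom.toLinearMap_apply,
            Algebra.TensorProduct.tmul_mul_tmul, inrHom_ι_mul_inlHom_ι]
          generalize LeftComodule.coact (k := k) (H := H) v' = p
          induction p with
          | zero => simp [Q']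
          | add p p' hp hp' => simp only [map_add, TensorProduct.tmul_add, hp, hp', Q']
          | tmul h v'' =>
            change _ = N (tensorSMul k H V (g ⊗ₜ h) (x ⊗ₜ w')) *
              (1 ⊗ₜ Smash.inrHom k H T T (ι' v''))
            rw [inlSMulInr_tmul, tensorSMul_tmul]
            simp [N]
      exact e _
  have hR' : diagCoact k H T (inlSMulInr w (LeftComodule.coact v)) =
      R (LeftComodule.coact.lTensor H (LeftComodule.coact v)) := by
    generalize LeftComodule.coact (k := k) (H := H) v = t
    induction t with
    | zero => simp
    | add s s' hs hs' => simp only [map_add, hs, hs']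
    | tmul x v' =>
      rw [inlSMulInr_tmul, diagCoact, Smash.prodMap_mul, LinearMap.lTensor_tmul, coactLeft_apply,
        coactRight_apply, coact_ι, coact_ι]
      generalize LeftComodule.coact (k := k) (H := H) v' = s
      induction s with
      | zero => simp
      | add s s' hs hs' => simp only [map_add, TensorProduct.tmul_add, mul_add, hs, hs']
      | tmul g v'' =>
        rw [hR, coactSMulRight_apply]
        generalize LeftComodule.coact (k := k) (H := H) (x • w) = p
        induction p with
        | zero => simp
        | add s s' hs hs' => simp only [map_add, add_mul, hs, hs']
        | tmul y w' => simp [N]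
  rw [inrHom_ι_mul_inlHom_ι, hQ', hR', hQR]

instance tensorAlgebra_isYDAlgebra : IsYDAlgebra k H T where
  coact_mul := prodMap_commutation_of_ι _ _ coactRight_ι_mul_coactLeft_ι
  act_mul := prodMap_commutation_of_ι _ _ actRight_ι_mul_actLeft_ι

end TensorYD

/-! ## The braided commutator -/

section BraidedComm

variable (k H A : Type*) [Field k] [Ring H] [Bialgebra k H] [Ring A] [Algebra k A]
  [ModuleAlgebra k H A] [ComoduleAlgebra k H A]

/-- The multiplication `a ⊗ b ↦ a b` on the braided tensor square. -/
def mulSmash : Smash k H A A →ₗ[k] A := Smash.prodMap (AlgHom.id k A) (AlgHom.id k A)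

/-- The braided commutator `(b, a) ↦ m c (b ⊗ a) - b a`. -/
def braidedComm : A →ₗ[k] A →ₗ[k] A :=
  ((LinearMap.mul k (Smash k H A A)).compl₁₂ (Smash.inrHom k H A A).toLinearMap
    (Smash.inlHom k H A A).toLinearMap).compr₂ (mulSmash k H A) - LinearMap.mul k A

/-- The subspace spanned by the braided commutators of `y ∈ Y` with `x ∈ X`. -/
def commSub (X Y : Submodule k A) : Submodule k A := Submodule.map₂ (braidedComm k H A) Y X

/-- The subspace `H ⊗ X` of `H ⊗ M`. -/
def tensorSub {M : Type*} [AddCommGroup M] [Module k M] (X : Submodule k M) :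
    Submodule k (H ⊗[k] M) := Submodule.map₂ (TensorProduct.mk k H M) ⊤ X

/-- A subspace which is stable under the action and the coaction. -/
structure IsStable (X : Submodule k A) : Prop where
  act_mem : ∀ (h : H), ∀ x ∈ X, ModuleAlgebra.act (k := k) h x ∈ X
  coact_mem : ∀ x ∈ X, LeftComodule.coact x ∈ tensorSub k H X

variable {k H A}

theorem tensorSub_le {M : Type*} [AddCommGroup M] [Module k M] {X : Submodule k M}
    {R : Submodule k (H ⊗[k] M)} : tensorSub k H X ≤ R ↔ ∀ (h : H), ∀ x ∈ X, h ⊗ₜ x ∈ R := by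
  rw [tensorSub, Submodule.map₂_le]
  simp

theorem tmul_mem_tensorSub {M : Type*} [AddCommGroup M] [Module k M] {X : Submodule k M} (h : H)
    {x : M} (hx : x ∈ X) : h ⊗ₜ x ∈ tensorSub k H X :=
  tensorSub_le.mp le_rfl h x hx

theorem tensorSub_mono {M : Type*} [AddCommGroup M] [Module k M] {X Y : Submodule k M}
    (h : X ≤ Y) : tensorSub k H X ≤ tensorSub k H Y := Submodule.map₂_le_map₂_right h

/-- A linear map sends the coaction of an element of a stable subspace into `R` if it does so with
all `h ⊗ x`. -/
theorem IsStable.map_coact_mem {X : Submodule k A} (hX : IsStable k H A X) {N : Type*}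
    [AddCommGroup N] [Module k N] {R : Submodule k N} (f : H ⊗[k] A →ₗ[k] N)
    (hf : ∀ (h : H), ∀ x ∈ X, f (h ⊗ₜ x) ∈ R) {x : A} (hx : x ∈ X) :
    f (LeftComodule.coact x) ∈ R :=
  (tensorSub_le (R := R.comap f)).mpr hf (hX.coact_mem x hx)

theorem mulSmash_mul (a b : A) :
    mulSmash k H A (Smash.inlHom k H A A a * Smash.inrHom k H A A b) = a * b :=
  Smash.prodMap_mul _ _ a b

theorem mulSmash_mul_inr (s : Smash k H A A) (b : A) :
    mulSmash k H A (s * Smash.inrHom k H A A b) = mulSmash k H A s * b :=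
  Smash.prodMap_mul_inr _ _ b s

theorem mulSmash_inl_mul (s : Smash k H A A) (a : A) :
    mulSmash k H A (Smash.inlHom k H A A a * s) = a * mulSmash k H A s :=
  Smash.prodMap_inl_mul _ _ a s

theorem braidedComm_apply (b a : A) : braidedComm k H A b a =
    mulSmash k H A (Smash.inrHom k H A A b * Smash.inlHom k H A A a) - b * a := rfl

/-- `h ⊗ x ↦ (h . a) ⊗ x`, so that `c(b ⊗ a)` is the image of the coaction of `b`. -/
def actTensor (a : A) : H ⊗[k] A →ₗ[k] Smash k H A A :=
  (Smash.ofTensor k H A A).toLinearMap ∘ₗ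
    ((ModuleAlgebra.act (k := k) (H := H) (A := A)).flip a).rTensor A

theorem actTensor_tmul (a x : A) (h : H) : actTensor a (h ⊗ₜ[k] x) =
    Smash.inlHom k H A A (ModuleAlgebra.act (k := k) h a) * Smash.inrHom k H A A x := by
  rw [Smash.inlHom_mul_inrHom]; rfl

theorem inr_mul_inl (b a : A) : Smash.inrHom k H A A b * Smash.inlHom k H A A a =
    actTensor a (LeftComodule.coact b) := Smash.inrHom_mul_inlHom a b

/-- Leibniz rule in the first variable. In c(bb' ⊗ a) the element a passes b' first and then b; the
second passage costs the commutator of b with b'₍₋₁₎ . a. -/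
theorem braidedComm_mul_left (b b' a : A) : braidedComm k H A (b * b') a =
    b * braidedComm k H A b' a + TensorProduct.lift ((LinearMap.mul k A ∘ₗ
      braidedComm k H A b) ∘ₗ (ModuleAlgebra.act (k := k) (H := H) (A := A)).flip a)
      (LeftComodule.coact b') := by
  have h : ∀ t : H ⊗[k] A, mulSmash k H A (Smash.inrHom k H A A b * actTensor a t) =
      b * mulSmash k H A (actTensor a t) + TensorProduct.lift ((LinearMap.mul k A ∘ₗ
      braidedComm k H A b) ∘ₗ (ModuleAlgebra.act (k := k) (H := H) (A := A)).flip a) t := by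
    intro t
    induction t with
    | zero => simp
    | add t t' ht ht' => simp only [map_add, mul_add, ht, ht']; abel
    | tmul g x =>
      rw [actTensor_tmul, ← mul_assoc, mulSmash_mul_inr, mulSmash_mul]
      simp [braidedComm_apply, mul_assoc]
  rw [braidedComm_apply, map_mul (Smash.inrHom k H A A), mul_assoc, inr_mul_inl, h,
    braidedComm_apply b' a, inr_mul_inl]
  rw [mul_sub, mul_assoc]
  abel

/-- Leibniz rule in the second variable: b passes a first, which acts on a by b₍₋₁₎, and the
remaining b₍₀₎ then passes a'. -/
theorem braidedComm_mul_right (b a a' : A) : braidedComm k H A b (a * a') =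
    braidedComm k H A b a * a' + TensorProduct.lift ((LinearMap.mul k A).compl₁₂
      ((ModuleAlgebra.act (k := k) (H := H) (A := A)).flip a) ((braidedComm k H A).flip a'))
      (LeftComodule.coact b) := by
  have h : ∀ t : H ⊗[k] A, mulSmash k H A (actTensor a t * Smash.inlHom k H A A a') =
      mulSmash k H A (actTensor a t) * a' + TensorProduct.lift ((LinearMap.mul k A).compl₁₂
      ((ModuleAlgebra.act (k := k) (H := H) (A := A)).flip a) ((braidedComm k H A).flip a')) t := by
    intro t
    induction t with
    | zero => simp
    | add t t' ht ht' => simp only [map_add, add_mul, ht, ht']; abel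
    | tmul g x =>
      rw [actTensor_tmul, mul_assoc, mulSmash_inl_mul, mulSmash_mul]
      simp [braidedComm_apply, mul_sub, mul_assoc]
  rw [braidedComm_apply, map_mul (Smash.inlHom k H A A), ← mul_assoc, inr_mul_inl, h,
    braidedComm_apply b a, inr_mul_inl]
  rw [sub_mul, mul_assoc]
  abel

/-! ### Consequences of the linearity and colinearity of the braiding; the Jacobi identity. -/

section Colinear

variable [IsYDAlgebra k H A]

theorem coact_mulSmash (s : Smash k H A A) : LeftComodule.coact (k := k) (H := H) (mulSmash k H A s) =
    (mulSmash k H A).lTensor H (diagCoact k H A s) := by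
  induction s using Smash.induction_on with
  | zero => simp
  | add s t hs ht => simp only [map_add, hs, ht]
  | mk a b =>
    rw [mulSmash_mul, ComoduleAlgebra.coact_mul, diagCoact, Smash.prodMap_mul, coactLeft_apply,
      coactRight_apply]
    generalize LeftComodule.coact (k := k) (H := H) a = t
    generalize LeftComodule.coact (k := k) (H := H) b = t'
    induction t with
    | zero => simp
    | add s s' hs hs' => simp only [map_add, add_mul, hs, hs']
    | tmul g x =>
      induction t' with
      | zero => simp
      | add s s' hs hs' => simp only [map_add, mul_add, hs, hs']
      | tmul h y => simp [mulSmash_mul]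

theorem coact_braidedComm (b a : A) : LeftComodule.coact (k := k) (H := H) (braidedComm k H A b a) =
    TensorProduct.map₂ (LinearMap.mul k H) (braidedComm k H A) (LeftComodule.coact b)
      (LeftComodule.coact a) := by
  rw [braidedComm_apply, map_sub, coact_mulSmash, ← IsYDAlgebra.coact_mul,
    ComoduleAlgebra.coact_mul, coactLeft_apply, coactRight_apply]
  generalize LeftComodule.coact (k := k) (H := H) a = t'
  generalize LeftComodule.coact (k := k) (H := H) b = t
  induction t with
  | zero => simp
  | add s s' hs hs' =>
    simp only [map_add, add_mul, LinearMap.add_apply, ← hs, ← hs']; abel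
  | tmul g x =>
    induction t' with
    | zero => simp
    | add s s' hs hs' => simp only [map_add, mul_add, ← hs, ← hs']; abel
    | tmul h y => simp [braidedComm_apply, TensorProduct.tmul_sub]

theorem act_mulSmash (h : H) (s : Smash k H A A) : ModuleAlgebra.act (k := k) h (mulSmash k H A s) =
    mulSmash k H A ((diagAct k H A s).ofConv h) := by
  induction s using Smash.induction_on with
  | zero => simp
  | add s t hs ht => simp only [map_add, hs, ht, WithConv.ofConv_add, LinearMap.add_apply]
  | mk a b =>
    rw [mulSmash_mul, ModuleAlgebra.act_mul, diagAct, Smash.prodMap_mul, LinearMap.convMul_apply]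
    generalize Coalgebra.comul (R := k) h = t
    induction t with
    | zero => simp
    | add s s' hs hs' => simp only [map_add, hs, hs']
    | tmul g x => simp [actLeft_apply, actRight_apply, mulSmash_mul]

theorem act_braidedComm (h : H) (b a : A) :
    ModuleAlgebra.act (k := k) h (braidedComm k H A b a) =
      TensorProduct.lift ((braidedComm k H A).compl₁₂
        ((ModuleAlgebra.act (k := k) (H := H) (A := A)).flip b)
        ((ModuleAlgebra.act (k := k) (H := H) (A := A)).flip a)) (Coalgebra.comul h) := by
  rw [braidedComm_apply, map_sub, act_mulSmash, ← IsYDAlgebra.act_mul, ModuleAlgebra.act_mul,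
    LinearMap.convMul_apply]
  generalize Coalgebra.comul (R := k) h = t
  induction t with
  | zero => simp
  | add s s' hs hs' => simp only [map_add, ← hs, ← hs']; abel
  | tmul g x => simp [actLeft_apply, actRight_apply, braidedComm_apply]

/-- The braided Jacobi identity. -/
theorem braidedComm_braidedComm (z y x : A) :
    braidedComm k H A z (braidedComm k H A y x) =
      braidedComm k H A (braidedComm k H A z y) x +
      TensorProduct.lift ((LinearMap.mul k A ∘ₗ braidedComm k H A z) ∘ₗ
        (ModuleAlgebra.act (k := k) (H := H) (A := A)).flip x) (LeftComodule.coact y) -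
      TensorProduct.lift ((LinearMap.mul k A).compl₁₂
        ((ModuleAlgebra.act (k := k) (H := H) (A := A)).flip y) ((braidedComm k H A).flip x))
        (LeftComodule.coact z) := by
  have h1 : braidedComm k H A z (mulSmash k H A (actTensor x (LeftComodule.coact y))) =
      TensorProduct.lift ((LinearMap.mul k A ∘ₗ braidedComm k H A z) ∘ₗ
        (ModuleAlgebra.act (k := k) (H := H) (A := A)).flip x) (LeftComodule.coact y) +
      mulSmash k H A (actTensor x (TensorProduct.map₂ (LinearMap.mul k H) (braidedComm k H A)
        (LeftComodule.coact z) (LeftComodule.coact y))) := by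
    generalize LeftComodule.coact (k := k) (H := H) y = t
    induction t with
    | zero => simp
    | add s s' hs hs' => simp only [map_add, hs, hs']; abel
    | tmul h' y' =>
      rw [actTensor_tmul, mulSmash_mul, braidedComm_mul_right]
      congr 1
      generalize LeftComodule.coact (k := k) (H := H) z = t
      induction t with
      | zero => simp
      | add s s' hs hs' => simp only [map_add, hs, hs', LinearMap.add_apply]
      | tmul h z' =>
        simp [actTensor_tmul, mulSmash_mul, ModuleAlgebra.mul_act]
  -- Write the inner commutator as m c(y ⊗ x) - yx and apply the Leibniz rule to both parts. By
  -- colinearity of the commutator, the remaining terms form m c([z, y] ⊗ x) - [z, y] x.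
  rw [braidedComm_apply y x, map_sub, inr_mul_inl, h1, braidedComm_mul_right,
    braidedComm_apply (braidedComm k H A z y) x, inr_mul_inl, coact_braidedComm]
  abel

end Colinear

/-! ### Stable subspaces -/

variable {X Y Z : Submodule k A}

theorem tensorSub_mul_tensorSub_le (X Y : Submodule k A) :
    tensorSub k H X * tensorSub k H Y ≤ tensorSub k H (X * Y) := by
  rw [tensorSub, tensorSub, Submodule.mul_le]
  intro m hm n hn
  have h1 : Submodule.map₂ (TensorProduct.mk k H A) ⊤ X ≤
      (tensorSub k H (X * Y)).comap ((LinearMap.mul k _).flip n) := by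
    refine tensorSub_le.mpr fun g x hx => ?_
    have h2 : Submodule.map₂ (TensorProduct.mk k H A) ⊤ Y ≤
        (tensorSub k H (X * Y)).comap (LinearMap.mul k (H ⊗[k] A) (g ⊗ₜ x)) :=
      tensorSub_le.mpr fun h y hy => by
        simpa using tmul_mem_tensorSub (g * h) (Submodule.mul_mem_mul hx hy)
    exact h2 hn
  exact h1 hm

theorem IsStable.mul (hX : IsStable k H A X) (hY : IsStable k H A Y) :
    IsStable k H A (X * Y) where
  act_mem h := by
    change X * Y ≤ (X * Y).comap (ModuleAlgebra.act (k := k) h)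
    rw [Submodule.mul_le]
    intro x hx y hy
    rw [Submodule.mem_comap, ModuleAlgebra.act_mul]
    generalize Coalgebra.comul (R := k) h = t
    induction t with
    | zero => simp
    | add s s' hs hs' => simp only [map_add]; exact add_mem hs hs'
    | tmul g g' =>
      simpa using Submodule.mul_mem_mul (hX.act_mem g x hx) (hY.act_mem g' y hy)
  coact_mem := by
    change X * Y ≤ (tensorSub k H (X * Y)).comap (LeftComodule.coact (k := k) (H := H))
    rw [Submodule.mul_le]
    intro x hx y hy
    rw [Submodule.mem_comap, ComoduleAlgebra.coact_mul]
    exact tensorSub_mul_tensorSub_le X Y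
      (Submodule.mul_mem_mul (hX.coact_mem x hx) (hY.coact_mem y hy))

theorem IsStable.iSup {ι : Sort*} {X : ι → Submodule k A} (hX : ∀ i, IsStable k H A (X i)) :
    IsStable k H A (⨆ i, X i) where
  act_mem h := by
    change ⨆ i, X i ≤ (⨆ i, X i).comap (ModuleAlgebra.act (k := k) h)
    exact iSup_le fun i x hx => Submodule.mem_iSup_of_mem i ((hX i).act_mem h x hx)
  coact_mem := by
    change ⨆ i, X i ≤ (tensorSub k H (⨆ i, X i)).comap (LeftComodule.coact (k := k) (H := H))
    exact iSup_le fun i x hx => tensorSub_mono (le_iSup X i) ((hX i).coact_mem x hx)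

theorem isStable_one : IsStable k H A (1 : Submodule k A) where
  act_mem h x hx := by
    obtain ⟨r, rfl⟩ := Submodule.mem_one.mp hx
    rw [Algebra.algebraMap_eq_smul_one, map_smul, ModuleAlgebra.act_one]
    exact Submodule.smul_mem _ _ (Submodule.algebraMap_mem _)
  coact_mem x hx := by
    obtain ⟨r, rfl⟩ := Submodule.mem_one.mp hx
    rw [Algebra.algebraMap_eq_smul_one, map_smul, ComoduleAlgebra.coact_one]
    exact Submodule.smul_mem _ _ (tmul_mem_tensorSub 1 (Submodule.one_le.mp le_rfl))

/-- This is where the linearity and colinearity of c are needed for the letter spaces: it makes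
stability propagate along the recursive definition of letters. -/
theorem IsStable.commSub [IsYDAlgebra k H A] (hX : IsStable k H A X) (hY : IsStable k H A Y) :
    IsStable k H A (commSub k H A X Y) where
  act_mem h := by
    change LyndonHopf.commSub k H A X Y ≤ (LyndonHopf.commSub k H A X Y).comap
      (ModuleAlgebra.act (k := k) h)
    refine Submodule.map₂_le.mpr fun y hy x hx => ?_
    rw [Submodule.mem_comap, act_braidedComm]
    generalize Coalgebra.comul (R := k) h = t
    induction t with
    | zero => simp
    | add s s' hs hs' => simp only [map_add]; exact add_mem hs hs'
    | tmul g g' =>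
      exact Submodule.apply_mem_map₂ _ (hY.act_mem g y hy) (hX.act_mem g' x hx)
  coact_mem := by
    change LyndonHopf.commSub k H A X Y ≤ (tensorSub k H (LyndonHopf.commSub k H A X Y)).comap
      (LeftComodule.coact (k := k) (H := H))
    refine Submodule.map₂_le.mpr fun y hy x hx => ?_
    rw [Submodule.mem_comap, coact_braidedComm]
    refine hY.map_coact_mem ((TensorProduct.map₂ (LinearMap.mul k H) (braidedComm k H A)).flip
      (LeftComodule.coact x)) (fun g y' hy' => ?_) hy
    refine hX.map_coact_mem (TensorProduct.map₂ (LinearMap.mul k H) (braidedComm k H A)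
      (g ⊗ₜ y')) (fun g' x' hx' => ?_) hx
    exact tmul_mem_tensorSub _ (Submodule.apply_mem_map₂ _ hy' hx')

theorem inr_mul_inl_mem (hX : IsStable k H A X) (hY : IsStable k H A Y) {x y : A} (hx : x ∈ X)
    (hy : y ∈ Y) : Smash.inrHom k H A A y * Smash.inlHom k H A A x ∈
      X.map (Smash.inlHom k H A A).toLinearMap * Y.map (Smash.inrHom k H A A).toLinearMap := by
  rw [inr_mul_inl]
  refine hY.map_coact_mem _ (fun h y' hy' => ?_) hy
  rw [actTensor_tmul]
  exact Submodule.mul_mem_mul (Submodule.mem_map_of_mem (hX.act_mem h x hx))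
    (Submodule.mem_map_of_mem hy')

theorem commSub_mono {X X' Y Y' : Submodule k A} (h : X ≤ X') (h' : Y ≤ Y') :
    commSub k H A X Y ≤ commSub k H A X' Y' := Submodule.map₂_le_map₂ h' h

theorem braidedComm_mem_commSub {x y : A} (hx : x ∈ X) (hy : y ∈ Y) :
    braidedComm k H A y x ∈ commSub k H A X Y := Submodule.apply_mem_map₂ _ hy hx

theorem commSub_iSup_right {ι : Sort*} (X : Submodule k A) (Y : ι → Submodule k A) :
    commSub k H A X (⨆ i, Y i) = ⨆ i, commSub k H A X (Y i) := Submodule.map₂_iSup_left _ _ _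

/-- `braidedComm_mul_left` replaces x by h . x and z by the components of its coaction; stability
returns them to X and Z, so at the level of subspaces the ordinary Leibniz rule holds. -/
theorem commSub_mul_right_le (hX : IsStable k H A X) (hZ : IsStable k H A Z) :
    commSub k H A X (Y * Z) ≤ commSub k H A X Y * Z ⊔ Y * commSub k H A X Z := by
  refine Submodule.map₂_le.mpr fun w hw x hx => ?_
  suffices h : Y * Z ≤ (commSub k H A X Y * Z ⊔ Y * commSub k H A X Z).comap
    ((braidedComm k H A).flip x) from h hw
  refine Submodule.mul_le.mpr fun y hy z hz => ?_
  rw [Submodule.mem_comap, LinearMap.flip_apply, braidedComm_mul_left, add_comm]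
  refine Submodule.add_mem_sup ?_ (Submodule.mul_mem_mul hy (braidedComm_mem_commSub hx hz))
  exact hZ.map_coact_mem _ (fun h z' hz' => Submodule.mul_mem_mul
    (braidedComm_mem_commSub (hX.act_mem h x hx) hy) hz') hz

/-- The Jacobi identity for subspaces, with coefficients from H absorbed by stability. It serves
when vw is not split at v in its Shirshov decomposition: X and Y then come from the decomposition of
v. -/
theorem commSub_commSub_le [IsYDAlgebra k H A] (hX : IsStable k H A X) (hY : IsStable k H A Y)
    (hZ : IsStable k H A Z) : commSub k H A (commSub k H A X Y) Z ≤
      commSub k H A X (commSub k H A Y Z) ⊔ commSub k H A X Z * Y ⊔ Y * commSub k H A X Z := by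
  refine Submodule.map₂_le.mpr fun z hz w hw => ?_
  suffices h : commSub k H A X Y ≤ (commSub k H A X (commSub k H A Y Z) ⊔ commSub k H A X Z * Y ⊔
    Y * commSub k H A X Z).comap (braidedComm k H A z) from h hw
  refine Submodule.map₂_le.mpr fun y hy x hx => ?_
  rw [Submodule.mem_comap, braidedComm_braidedComm, sub_eq_add_neg]
  refine Submodule.add_mem_sup (Submodule.add_mem_sup ?_ ?_) (neg_mem ?_)
  · exact braidedComm_mem_commSub hx (braidedComm_mem_commSub hy hz)
  · exact hY.map_coact_mem _ (fun h y' hy' => Submodule.mul_mem_mul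
      (braidedComm_mem_commSub (hX.act_mem h x hx) hz) hy') hy
  · exact hZ.map_coact_mem _ (fun h z' hz' => Submodule.mul_mem_mul
      (hY.act_mem h y hy) (braidedComm_mem_commSub hx hz')) hz

end BraidedComm

/-! ## Lyndon words -/

section LyndonWords

variable {A : Type*} [LinearOrder A]

/-- `u` followed by anything is smaller than `z`. -/
def ExtLT (u z : List A) : Prop := ∀ a : List A, u ++ a < z

theorem lt_append_of_ne_nil (u : List A) {a : List A} (ha : a ≠ []) : u < u ++ a := by
  induction u with
  | nil => cases a with
    | nil => exact absurd rfl ha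
    | cons => exact List.nil_lt_cons _ _
  | cons c u ih => exact List.cons_lt_cons_iff.mpr (Or.inr ⟨rfl, ih⟩)

theorem le_append (u a : List A) : u ≤ u ++ a := by
  by_cases ha : a = []
  · simp [ha]
  · exact (lt_append_of_ne_nil u ha).le

theorem append_lt_append_left (u : List A) {a b : List A} (h : a < b) : u ++ a < u ++ b := by
  induction u with
  | nil => exact h
  | cons c u ih => exact List.cons_lt_cons_iff.mpr (Or.inr ⟨rfl, ih⟩)

theorem append_le_append_left (u : List A) {a b : List A} (h : a ≤ b) : u ++ a ≤ u ++ b := by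
  rcases h.eq_or_lt with rfl | h
  · exact le_rfl
  · exact (append_lt_append_left u h).le

/-- Either v is a proper prefix of x, or the order is decided at a first differing letter, and then
no continuation of either word can change it. -/
theorem lt_cases {v x : List A} (h : v < x) :
    (∃ y, y ≠ [] ∧ x = v ++ y) ∨ ∀ a b : List A, v ++ a < x ++ b := by
  induction v generalizing x with
  | nil => exact Or.inl ⟨x, by rintro rfl; exact lt_irrefl _ h, rfl⟩
  | cons c v ih =>
    cases x with
    | nil => exact absurd h (List.not_lt_nil _)
    | cons d x =>
      rcases List.cons_lt_cons_iff.mp h with h' | ⟨rfl, h'⟩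
      · exact Or.inr fun a b => List.cons_lt_cons_iff.mpr (Or.inl h')
      · rcases ih h' with ⟨y, hy, rfl⟩ | h
        · exact Or.inl ⟨y, hy, rfl⟩
        · exact Or.inr fun a b => List.cons_lt_cons_iff.mpr (Or.inr ⟨rfl, h a b⟩)

theorem append_lt_append {v x : List A} (h : v < x) (hl : x.length ≤ v.length) (a b : List A) :
    v ++ a < x ++ b := by
  rcases lt_cases h with ⟨y, hy, rfl⟩ | h
  · have := List.length_pos_iff.mpr hy
    rw [List.length_append] at hl
    omega
  · exact h a b

theorem ExtLT.lt {u z : List A} (h : ExtLT u z) : u < z := by simpa using h []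

theorem ExtLT.trans_le {u z z' : List A} (h : ExtLT u z) (h' : z ≤ z') : ExtLT u z' :=
  fun a => (h a).trans_le h'

theorem extLT_of_lt {u z : List A} (h : u < z) (hl : z.length ≤ u.length) : ExtLT u z :=
  fun a => by simpa using append_lt_append h hl a []

theorem ExtLT.append_left {w z : List A} (v : List A) (h : ExtLT w z) :
    ExtLT (v ++ w) (v ++ z) := fun a => by
  rw [List.append_assoc]
  exact append_lt_append_left v (h a)

theorem ExtLT.append_right {v z : List A} (w : List A) (h : ExtLT v z) : ExtLT (v ++ w) z :=
  fun a => by rw [List.append_assoc]; exact h _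

/-- A proper suffix of a Lyndon word is larger than the word. -/
theorem IsLyndon.extLT {u₁ u₂ : List A} (h : IsLyndon (u₁ ++ u₂)) (h₁ : u₁ ≠ []) (h₂ : u₂ ≠ []) :
    ExtLT (u₁ ++ u₂) u₂ :=
  extLT_of_lt (h.2 u₁ u₂ h₁ h₂ rfl) (by simp)

theorem IsLyndon.append_lt {v w : List A} (hv : v ≠ []) (hw : IsLyndon w) (h : v < w) :
    v ++ w < w := by
  rcases lt_cases h with ⟨y, hy, rfl⟩ | h
  · exact append_lt_append_left v (hw.2 v y hv hy rfl)
  · simpa using h w []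

theorem IsLyndon.append {v w : List A} (hv : IsLyndon v) (hw : IsLyndon w) (h : v < w) :
    IsLyndon (v ++ w) := by
  refine ⟨by simp [hv.1], fun u₁ u₂ h₁ h₂ e => ?_⟩
  have hvw := hw.append_lt hv.1 h
  rcases List.append_eq_append_iff.mp e with ⟨x, rfl, rfl⟩ | ⟨x, rfl, rfl⟩
  · by_cases hx : x = []
    · subst hx; simpa using hvw
    · exact hvw.trans (hw.2 x u₂ hx h₂ rfl)
  · by_cases hx : x = []
    · subst hx; simpa using hvw
    · exact append_lt_append (hv.2 u₁ x h₁ hx rfl) (by simp) _ _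

/-! ### The Shirshov decomposition. -/

section Shirshov

variable {u : List A}

theorem isLyndon_drop_shirshovIndex (hu : ¬ u.length ≤ 1) : IsLyndon (u.drop (shirshovIndex u)) := by
  have hne : {i | 1 ≤ i ∧ IsLyndon (u.drop i)}.Nonempty := by
    by_contra h
    have h0 : shirshovIndex u = 0 := by
      rw [shirshovIndex, Set.not_nonempty_iff_eq_empty.mp h, Nat.sInf_empty]
    have := (shirshovIndex_spec hu).1
    omega
  exact (Nat.sInf_mem hne).2

theorem shirshovIndex_le {j : ℕ} (hj : 1 ≤ j) (h : IsLyndon (u.drop j)) : shirshovIndex u ≤ j :=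
  Nat.sInf_le ⟨hj, h⟩

/-- The longest proper Lyndon suffix is the smallest proper suffix. -/
theorem drop_shirshovIndex_le {j : ℕ} (hj : 1 ≤ j) (hj' : j < u.length) :
    u.drop (shirshovIndex u) ≤ u.drop j := by
  obtain ⟨j₀, hj₀, hmin⟩ := Finset.exists_min_image (Finset.Ico 1 u.length) (fun j => u.drop j)
    ⟨j, by simp [hj, hj']⟩
  rw [Finset.mem_Ico] at hj₀
  have hu : ¬ u.length ≤ 1 := by omega
  -- The smallest proper suffix is Lyndon, since its own proper suffixes are proper suffixes of u
  -- and therefore larger.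
  have hL : IsLyndon (u.drop j₀) := by
    refine ⟨by simp; omega, fun x y hx hy e => ?_⟩
    have hlx := List.length_pos_iff.mpr hx
    have hly := List.length_pos_iff.mpr hy
    have hl := congrArg List.length e
    rw [List.length_drop, List.length_append] at hl
    have hy' : y = u.drop (j₀ + x.length) := by
      rw [← List.drop_drop, e, List.drop_left]
    refine lt_of_le_of_ne ?_ fun h => ?_
    · rw [hy']
      exact hmin _ (by rw [Finset.mem_Ico]; omega)
    · have := congrArg List.length h
      rw [List.length_drop] at this
      omega
  have hle := shirshovIndex_le hj₀.1 hL
  refine le_trans ?_ (hmin j (by simp [hj, hj']))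
  rcases hle.eq_or_lt with h | h
  · rw [h]
  -- If the longest Lyndon suffix is strictly longer, then u.drop j₀ is a proper suffix of it, hence
  -- larger than it.
  · have hi := isLyndon_drop_shirshovIndex hu
    have e : u.drop (shirshovIndex u) =
        (u.drop (shirshovIndex u)).take (j₀ - shirshovIndex u) ++ u.drop j₀ := by
      conv_lhs => rw [← List.take_append_drop (j₀ - shirshovIndex u) (u.drop (shirshovIndex u))]
      rw [List.drop_drop, Nat.add_sub_cancel' hle]
    refine (hi.2 _ _ ?_ ?_ e).le
    · intro h'
      have := congrArg List.length h'
      simp at this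
      omega
    · simp; omega

/-- Write u = vw and suppose v has a proper suffix x < v. If x is not a prefix of v, then xw < vw =
u, contrary to u being Lyndon. If v = xz, then u < xw gives zw < w, although w is the smallest
proper suffix of u. -/
theorem IsLyndon.take_shirshovIndex (h : IsLyndon u) (hu : ¬ u.length ≤ 1) :
    IsLyndon (u.take (shirshovIndex u)) := by
  have hs := shirshovIndex_spec hu
  set w := u.drop (shirshovIndex u) with hw
  have e : u = u.take (shirshovIndex u) ++ w := (List.take_append_drop _ _).symm
  have hlv : (u.take (shirshovIndex u)).length = shirshovIndex u := by simp; omega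
  have hwn : w ≠ [] := (isLyndon_drop_shirshovIndex hu).1
  refine ⟨fun h' => by simp [h'] at hlv; omega, fun y x hy hx e' => ?_⟩
  have hly := List.length_pos_iff.mpr hy
  have hlx := List.length_pos_iff.mpr hx
  have hl' := congrArg List.length e'
  rw [hlv, List.length_append] at hl'
  rw [e'] at e
  by_contra hcon
  rw [e'] at hcon
  have hlt : x < y ++ x := lt_of_le_of_ne (not_lt.mp hcon) fun h' => by
    have := congrArg List.length h'
    rw [List.length_append] at this
    omega
  have hu' : u < x ++ w := h.2 y (x ++ w) hy (by simp [hx]) (by rw [e]; simp)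
  rcases lt_cases hlt with ⟨z, hz, hxz⟩ | hlt
  · rw [e, hxz, List.append_assoc] at hu'
    have h1 : z ++ w < w := by
      by_contra h1
      exact absurd hu' (not_lt.mpr (append_le_append_left x (not_lt.mp h1)))
    have hlz := congrArg List.length hxz
    rw [List.length_append, List.length_append] at hlz
    have h2 : u.drop x.length = z ++ w := by
      rw [e, hxz, List.append_assoc, List.drop_left]
    have h3 := drop_shirshovIndex_le (u := u) (j := x.length) hlx (by omega)
    rw [h2, ← hw] at h3
    exact absurd h1 (not_lt.mpr h3)
  · rw [e] at hu'
    exact absurd hu' (not_lt.mpr (hlt w w).le)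

/-- A longer Lyndon suffix would be v'w with v' a proper nonempty suffix of v, and then v'w < w. But
w ≤ v' ≤ v'w, because the Shirshov suffix of v is its smallest proper suffix. -/
theorem shirshovIndex_append {v w : List A} (hv : IsLyndon v) (hw : IsLyndon w)
    (h : v.length ≤ 1 ∨ w ≤ v.drop (shirshovIndex v)) : shirshovIndex (v ++ w) = v.length := by
  have hlv := List.length_pos_iff.mpr hv.1
  have hlw := List.length_pos_iff.mpr hw.1
  have hle : shirshovIndex (v ++ w) ≤ v.length :=
    shirshovIndex_le hlv (by rwa [List.drop_left])
  refine hle.eq_or_lt.resolve_right fun hlt => ?_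
  have hu : ¬ (v ++ w).length ≤ 1 := by rw [List.length_append]; omega
  have h1 := (shirshovIndex_spec hu).1
  have hL := isLyndon_drop_shirshovIndex hu
  rw [List.drop_append_of_le_length hle] at hL
  have hne : v.drop (shirshovIndex (v ++ w)) ≠ [] := by simp; omega
  have h2 := hL.2 _ _ hne hw.1 rfl
  have h3 := (le_append (v.drop (shirshovIndex (v ++ w))) w).trans_lt h2
  have h4 := (h.resolve_left (by omega)).trans (drop_shirshovIndex_le h1 hlt)
  exact absurd h3 (not_lt.mpr h4)

end Shirshov

end LyndonWords

/-! ## Straightening of products of bracket letters -/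

section Straightening

variable {k H A : Type*} [Field k] [Ring H] [Bialgebra k H] [Ring A] [Algebra k A]
  [ModuleAlgebra k H A] [ComoduleAlgebra k H A]

variable {α : Type*} [LinearOrder α]

/-- The product of the subspaces `L v` for the super-letters `v` of the super-word `s`. -/
def superProd (L : List α → Submodule k A) (s : List (List α)) : Submodule k A := (s.map L).prod

/-- The sum of the products of the `L v` over the super-words in `S`. -/
def superSpan (L : List α → Submodule k A) (S : Set (List (List α))) : Submodule k A :=
  ⨆ s ∈ S, superProd L s

/-- The nonempty monotonic super-words with super-letters in `P`. -/
def monotonicIn (P : Set (List α)) : Set (List (List α)) :=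
  {s | IsMonotonic s ∧ s ≠ [] ∧ ∀ v ∈ s, v ∈ P}

/-- The nonempty monotonic super-words with super-letters in `P` and total length `n`. -/
def monotonicInLength (P : Set (List α)) (n : ℕ) : Set (List (List α)) :=
  {s | s ∈ monotonicIn P ∧ s.flatten.length = n}

theorem superProd_append (L : List α → Submodule k A) (s t : List (List α)) :
    superProd L (s ++ t) = superProd L s * superProd L t := by
  simp [superProd]

theorem superProd_cons (L : List α → Submodule k A) (v : List α) (t : List (List α)) :
    superProd L (v :: t) = L v * superProd L t := by
  simp [superProd]

theorem superProd_nil (L : List α → Submodule k A) : superProd L [] = 1 := rfl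

theorem superProd_singleton (L : List α → Submodule k A) (v : List α) :
    superProd L [v] = L v := by
  simp [superProd]

theorem superProd_le_superSpan (L : List α → Submodule k A) {S : Set (List (List α))}
    {s : List (List α)} (hs : s ∈ S) : superProd L s ≤ superSpan L S :=
  le_iSup₂_of_le s hs le_rfl

theorem superSpan_mono (L : List α → Submodule k A) {S S' : Set (List (List α))} (h : S ⊆ S') :
    superSpan L S ≤ superSpan L S' :=
  iSup₂_le fun _ hs => superProd_le_superSpan L (h hs)

theorem mul_superSpan_mul_le {L : List α → Submodule k A} {S : Set (List (List α))}
    {X Y R : Submodule k A} (h : ∀ s ∈ S, X * superProd L s * Y ≤ R) :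
    X * superSpan L S * Y ≤ R := by
  simp only [superSpan, Submodule.mul_iSup, Submodule.iSup_mul]
  exact iSup₂_le h

theorem superSpan_mul_superSpan_le {L : List α → Submodule k A} {S S' : Set (List (List α))}
    {R : Submodule k A} (h : ∀ s ∈ S, ∀ s' ∈ S', superProd L (s ++ s') ≤ R) :
    superSpan L S * superSpan L S' ≤ R := by
  simp only [superSpan, Submodule.mul_iSup, Submodule.iSup_mul]
  exact iSup₂_le fun s' hs' => iSup₂_le fun s hs => by
    rw [← superProd_append]; exact h s hs s' hs'

theorem monotonicInLength_subset (P : Set (List α)) (n : ℕ) :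
    monotonicInLength P n ⊆ monotonicIn P := fun _ h => h.1

theorem monotonicIn_mono {P P' : Set (List α)} (h : P ⊆ P') : monotonicIn P ⊆ monotonicIn P' :=
  fun _ hs => ⟨hs.1, hs.2.1, fun v hv => h (hs.2.2 v hv)⟩

variable (H) in
/-- The properties of the spaces `L u` of `u`-bracket letters used for straightening. -/
structure IsLyndonFamily (L : List α → Submodule k A) : Prop where
  stable : ∀ u, IsLyndon u → IsStable k H A (L u)
  commSub_eq : ∀ v w, IsLyndon v → IsLyndon w → v < w → shirshovIndex (v ++ w) = v.length →
    commSub k H A (L v) (L w) = L (v ++ w)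
  mul_le : ∀ v w, IsLyndon v → IsLyndon w →
    L v * L w ≤ L w * L v ⊔ commSub k H A (L v) (L w)

theorem IsLyndonFamily.stable_superProd {L : List α → Submodule k A} (hL : IsLyndonFamily H L)
    {s : List (List α)} (hs : ∀ v ∈ s, IsLyndon v) : IsStable k H A (superProd L s) := by
  induction s with
  | nil => exact isStable_one
  | cons v s ih =>
    rw [superProd_cons]
    exact (hL.stable v (hs v (by simp))).mul (ih fun w hw => hs w (by simp [hw]))

theorem IsLyndonFamily.stable_superSpan {L : List α → Submodule k A} (hL : IsLyndonFamily H L)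
    (P : Set (List α)) : IsStable k H A (superSpan L (monotonicIn P)) :=
  .iSup fun _ => .iSup fun hs => hL.stable_superProd hs.1.1

theorem commSub_one_right (X : Submodule k A) : commSub k H A X 1 = ⊥ := by
  refine le_bot_iff.mp (Submodule.map₂_le.mpr fun y hy x hx => ?_)
  obtain ⟨r, rfl⟩ := Submodule.mem_one.mp hy
  have : braidedComm k H A 1 x = 0 := by
    have h := mulSmash_mul (k := k) (H := H) x 1
    rw [map_one, mul_one, mul_one] at h
    rw [braidedComm_apply, map_one, one_mul, h, one_mul, sub_self]
  rw [Algebra.algebraMap_eq_smul_one, map_smul, LinearMap.smul_apply, this, smul_zero]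
  exact zero_mem _

/-- The iterated braided Leibniz rule. -/
theorem commSub_superProd_le {L : List α → Submodule k A} (hL : IsLyndonFamily H L)
    {X R : Submodule k A} (hX : IsStable k H A X) {s : List (List α)} (hs : ∀ v ∈ s, IsLyndon v)
    (h : ∀ pre t post, s = pre ++ t :: post →
      superProd L pre * commSub k H A X (L t) * superProd L post ≤ R) :
    commSub k H A X (superProd L s) ≤ R := by
  -- The prefix `pre₀` collects the letters already passed, so that the bound by R keeps its form
  -- along the induction on s.
  suffices key : ∀ pre₀, (∀ pre t post, s = pre ++ t :: post →
      superProd L (pre₀ ++ pre) * commSub k H A X (L t) * superProd L post ≤ R) →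
      superProd L pre₀ * commSub k H A X (superProd L s) ≤ R by
    simpa [superProd_nil] using key [] (by simpa using h)
  clear h
  induction s with
  | nil => intro pre₀ _; rw [superProd_nil, commSub_one_right]; simp
  | cons v s ih =>
    intro pre₀ h
    have hs' : ∀ w ∈ s, IsLyndon w := fun w hw => hs w (by simp [hw])
    rw [superProd_cons]
    refine (mul_le_mul' le_rfl (commSub_mul_right_le hX
      (hL.stable_superProd hs'))).trans ?_
    rw [Submodule.mul_sup]
    refine sup_le ?_ ?_
    · rw [← mul_assoc]
      simpa using h [] v s rfl
    · rw [← mul_assoc, ← superProd_singleton L v, ← superProd_append]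
      refine ih hs' (pre₀ ++ [v]) fun pre t post e => ?_
      have := h (v :: pre) t post (by simp [e])
      simpa using this

theorem pairwise_or_exists_lt (s : List (List α)) : s.Pairwise (fun v v' => v' ≤ v) ∨
    ∃ pre a b post, s = pre ++ a :: b :: post ∧ a < b := by
  induction s with
  | nil => exact Or.inl List.Pairwise.nil
  | cons c s ih =>
    rcases ih with h | ⟨pre, a, b, post, rfl, h⟩
    · cases s with
      | nil => exact Or.inl (List.pairwise_singleton _ _)
      | cons e s =>
        rcases lt_or_ge c e with hce | hce
        · exact Or.inr ⟨[], c, e, s, rfl, hce⟩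
        · refine Or.inl (List.pairwise_cons.mpr ⟨fun x hx => ?_, h⟩)
          rcases List.mem_cons.mp hx with rfl | hx
          · exact hce
          · exact ((List.pairwise_cons.mp h).1 x hx).trans hce
    · exact Or.inr ⟨c :: pre, a, b, post, rfl, h⟩

variable [Finite α]

/-- Finiteness makes the relation > on super-words of fixed total length well founded; this is what
the finiteness of the alphabet is used for. -/
theorem finite_superWords (n : ℕ) :
    {s : List (List α) | (∀ v ∈ s, v ≠ []) ∧ s.flatten.length = n}.Finite := by
  have : Finite {l : List α // l.length ≤ n} := (List.finite_length_le α n).to_subtype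
  refine ((List.finite_length_le {l : List α // l.length ≤ n} n).image
    (List.map Subtype.val)).subset ?_
  rintro s ⟨hs, hn⟩
  have h1 : ∀ v ∈ s, v.length ≤ n := fun v hv => by
    rw [← hn]; exact (List.sublist_flatten_of_mem hv).length_le
  have h2 : s.length ≤ n := by
    rw [← hn, List.length_flatten]
    calc s.length = (s.map List.length).length * 1 := by simp
      _ ≤ (s.map List.length).sum := by
        rw [← smul_eq_mul]
        refine List.card_nsmul_le_sum _ _ fun x hx => ?_
        obtain ⟨v, hv, rfl⟩ := List.mem_map.mp hx
        exact List.length_pos_iff.mpr (hs v hv)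
  lift s to List {l : List α // l.length ≤ n} using h1
  exact ⟨s, by simpa using h2, rfl⟩

/-- Products of letters are combinations of monotonic words, provided that the commutators are. -/
theorem superProd_le_of_commSub_le {L : List α → Submodule k A} (hL : IsLyndonFamily H L)
    {P : Set (List α)} (hP : IsUpperSet P) (N : ℕ)
    (hyp : ∀ a b, IsLyndon a → IsLyndon b → a < b → a ∈ P → a.length + b.length ≤ N →
      commSub k H A (L a) (L b) ≤
        superSpan L (monotonicInLength (Set.Ici (a ++ b)) (a.length + b.length)))
    {s : List (List α)} (hne : s ≠ []) (hs : ∀ v ∈ s, IsLyndon v ∧ v ∈ P)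
    (hN : s.flatten.length ≤ N) :
    superProd L s ≤ superSpan L (monotonicInLength P s.flatten.length) := by
  obtain ⟨n, hn⟩ : ∃ n, s.flatten.length = n := ⟨_, rfl⟩
  rw [hn]
  have hmem : s ∈ {s : List (List α) | (∀ v ∈ s, v ≠ []) ∧ s.flatten.length = n} :=
    ⟨fun v hv => (hs v hv).1.1, hn⟩
  -- Descending lexicographic induction over super-words of total length n. An ascent a < b is
  -- replaced either by b, a or by a monotonic word in letters ≥ ab > a; both raise the first
  -- changed super-letter, hence the super-word.
  have hwf := (finite_superWords (α := α) n).wellFoundedOn (r := (· > ·))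
  revert hne hs hN
  refine hwf.induction (P := fun s => s ≠ [] → (∀ v ∈ s, IsLyndon v ∧ v ∈ P) →
    s.flatten.length ≤ N → superProd L s ≤ superSpan L (monotonicInLength P n)) hmem ?_
  · clear hmem hn s
    rintro s ⟨-, hn⟩ ih hne hs hN
    rcases pairwise_or_exists_lt s with h | ⟨pre, a, b, post, rfl, h⟩
    · exact superProd_le_superSpan L ⟨⟨⟨fun v hv => (hs v hv).1, h⟩, hne,
        fun v hv => (hs v hv).2⟩, hn⟩
    · have ha := hs a (by simp)
      have hb := hs b (by simp)
      have e : superProd L (pre ++ a :: b :: post) =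
          superProd L pre * (L a * L b) * superProd L post := by
        simp [superProd_append, superProd_cons, mul_assoc]
      have hl : pre.flatten.length + (a.length + b.length) + post.flatten.length = n := by
        rw [← hn]; simp; omega
      rw [hn] at hN
      have aux : ∀ s', (∀ v ∈ s', IsLyndon v ∧ v ∈ P) → s' ≠ [] →
          s'.flatten.length = a.length + b.length → a :: b :: post < s' ++ post →
          superProd L pre * superProd L s' * superProd L post ≤
            superSpan L (monotonicInLength P n) := by
        intro s' hs' hne' hl' hlt
        have hmem : ∀ v ∈ pre ++ (s' ++ post), IsLyndon v ∧ v ∈ P := by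
          intro v hv
          simp only [List.mem_append] at hv
          rcases hv with hv | hv | hv
          · exact hs v (by simp [hv])
          · exact hs' v hv
          · exact hs v (by simp [hv])
        have hlen : (pre ++ (s' ++ post)).flatten.length = n := by
          rw [← hl, List.flatten_append, List.flatten_append, List.length_append,
            List.length_append, hl']; omega
        rw [mul_assoc, ← superProd_append, ← superProd_append]
        exact ih _ ⟨fun v hv => (hmem v hv).1.1, hlen⟩ (append_lt_append_left pre hlt)
          (by simp [hne']) hmem (hlen.trans_le hN)
      rw [e]
      refine (mul_le_mul' (mul_le_mul' le_rfl
        (hL.mul_le a b ha.1 hb.1)) le_rfl).trans ?_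
      rw [Submodule.mul_sup, Submodule.sup_mul]
      refine sup_le ?_ ?_
      · have := aux [b, a] (by simp [ha, hb]) (by simp) (by simp; omega)
          (List.cons_lt_cons_iff.mpr (Or.inl h))
        simpa [superProd_cons, superProd_nil] using this
      · refine (mul_le_mul' (mul_le_mul' le_rfl
          (hyp a b ha.1 hb.1 h ha.2 (by omega))) le_rfl).trans ?_
        refine mul_superSpan_mul_le fun s' hs' => ?_
        have hge : ∀ v ∈ s', a < v := fun v hv =>
          (lt_append_of_ne_nil a hb.1.1).trans_le (hs'.1.2.2 v hv)
        refine aux s' (fun v hv => ⟨hs'.1.1.1 v hv, hP (hge v hv).le ha.2⟩) hs'.1.2.1 hs'.2 ?_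
        cases s' with
        | nil => exact absurd rfl hs'.1.2.1
        | cons c s' => exact List.cons_lt_cons_iff.mpr (Or.inl (hge c (by simp)))

/-! ### Straightening of commutators. -/

variable [IsYDAlgebra k H A]

/-- The commutator of two letters `L v`, `L w` with `v < w` is a combination of monotonic words in
letters `≥ vw`. -/
theorem commSub_le_superSpan {L : List α → Submodule k A} (hL : IsLyndonFamily H L)
    {v w : List α} (hv : IsLyndon v) (hw : IsLyndon w) (hvw : v < w) :
    commSub k H A (L v) (L w) ≤
      superSpan L (monotonicInLength (Set.Ici (v ++ w)) (v.length + w.length)) := by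
  -- Three nested inductions: on |v| + |w|, then downwards on vw among the finitely many words of
  -- that length, then on |v|.
  obtain ⟨N, hN⟩ : ∃ N, v.length + w.length = N := ⟨_, rfl⟩
  induction N using Nat.strong_induction_on generalizing v w with
  | _ N ihN =>
  have ihN' : ∀ {v w : List α}, IsLyndon v → IsLyndon w → v < w → v.length + w.length < N →
      commSub k H A (L v) (L w) ≤
        superSpan L (monotonicInLength (Set.Ici (v ++ w)) (v.length + w.length)) :=
    fun hv hw hvw hlt => ihN _ hlt hv hw hvw rfl
  have hwf := (List.finite_length_eq α N).wellFoundedOn (r := (· > ·))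
  obtain ⟨x, hx⟩ : ∃ x, v ++ w = x := ⟨_, rfl⟩
  have hmem : x ∈ {l : List α | l.length = N} := by
    rw [← hx, Set.mem_ofPred_eq, List.length_append, hN]
  revert v w
  refine hwf.induction (P := fun x => ∀ {v w : List α}, IsLyndon v → IsLyndon w → v < w →
    v.length + w.length = N → v ++ w = x → commSub k H A (L v) (L w) ≤
      superSpan L (monotonicInLength (Set.Ici (v ++ w)) (v.length + w.length))) hmem ?_
  clear hmem x
  rintro x - ihx v w hv hw hvw hN hx
  have ihx' : ∀ {v' w' : List α}, IsLyndon v' → IsLyndon w' → v' < w' →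
      v'.length + w'.length = N → x < v' ++ w' → commSub k H A (L v') (L w') ≤
        superSpan L (monotonicInLength (Set.Ici (v' ++ w')) (v'.length + w'.length)) :=
    fun {v' w'} hv' hw' hvw' hN' hlt =>
      ihx (v' ++ w') (by rw [Set.mem_ofPred_eq, List.length_append, hN']) hlt hv' hw' hvw' hN' rfl
  obtain ⟨m, hm⟩ : ∃ m, v.length = m := ⟨_, rfl⟩
  induction m using Nat.strong_induction_on generalizing v w with
  | _ m ihm =>
  -- In this case v, w is the Shirshov decomposition of vw, and the commutator is the single letter
  -- space L(vw).
  by_cases hsh : v.length ≤ 1 ∨ w ≤ v.drop (shirshovIndex v)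
  · rw [hL.commSub_eq v w hv hw hvw (shirshovIndex_append hv hw hsh), ← superProd_singleton L]
    exact superProd_le_superSpan L ⟨⟨⟨by simpa using hv.append hw hvw, List.pairwise_singleton _ _⟩,
      by simp, by simp⟩, by simp⟩
  rw [not_or, not_le (a := w)] at hsh
  obtain ⟨hlen, hlt⟩ := hsh
  have hidx := shirshovIndex_spec hlen
  obtain ⟨v₁, v₂, hv₁, hv₂, e, hi⟩ : ∃ v₁ v₂, v₁ = v.take (shirshovIndex v) ∧
      v₂ = v.drop (shirshovIndex v) ∧ v = v₁ ++ v₂ ∧ shirshovIndex v = v₁.length :=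
    ⟨_, _, rfl, rfl, (List.take_append_drop _ _).symm, by simp; omega⟩
  have hL₁ : IsLyndon v₁ := hv₁ ▸ hv.take_shirshovIndex hlen
  have hL₂ : IsLyndon v₂ := hv₂ ▸ isLyndon_drop_shirshovIndex hlen
  rw [← hv₂] at hlt
  clear hv₁ hv₂
  subst e
  have hext : ExtLT (v₁ ++ v₂) v₂ := hv.extLT hL₁.1 hL₂.1
  have h₁v : v₁ < v₁ ++ v₂ := lt_append_of_ne_nil v₁ hL₂.1
  have h₁₂ : v₁ < v₂ := h₁v.trans hext.lt
  have h₂w : v₂ ++ w < w := hw.append_lt hL₂.1 hlt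
  have hl₁ := List.length_pos_iff.mpr hL₁.1
  have hl₂ := List.length_pos_iff.mpr hL₂.1
  rw [List.length_append] at hN hm
  -- Products of letters ≥ x of total length N can be sorted: a commutator of a < b met on the way
  -- is shorter than N, or else ab > a ≥ x and the downward induction applies.
  have hstr : ∀ s : List (List α), s ≠ [] → (∀ v ∈ s, IsLyndon v ∧ x ≤ v) →
      s.flatten.length = N → superProd L s ≤ superSpan L (monotonicInLength (Set.Ici x) N) := by
    intro s hne hs hN'
    rw [← hN']
    refine superProd_le_of_commSub_le hL (isUpperSet_Ici x) N (fun a b ha hb hab hxa hle => ?_)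
      hne hs hN'.le
    rcases hle.lt_or_eq with h | h
    · exact ihN' ha hb hab h
    · exact ihx' ha hb hab h (lt_of_le_of_lt hxa (lt_append_of_ne_nil a hb.1))
  have hx₂ : x ≤ v₂ := by rw [← hx]; exact (hext w).le
  have hx₁w : x ≤ v₁ ++ w := by
    rw [← hx, List.append_assoc]; exact append_le_append_left v₁ h₂w.le
  have hv₁w := ihN' hL₁ hw (h₁v.trans hvw) (by omega)
  have hv₂w := ihN' hL₂ hw hlt (by omega)
  rw [List.length_append, hN, hx, ← hL.commSub_eq v₁ v₂ hL₁ hL₂ h₁₂ hi]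
  refine (commSub_commSub_le (hL.stable _ hL₁) (hL.stable _ hL₂) (hL.stable _ hw)).trans
    (sup_le (sup_le ?_ ?_) ?_)
  -- The term [v₁, [v₂, w]]. Straightening the inner commutator gives words in letters t ≥ v₂w, and
  -- the Leibniz rule then produces commutators [v₁, t] with v₁t ≥ v₁v₂w = x.
  · refine (commSub_mono le_rfl hv₂w).trans ?_
    simp only [superSpan, commSub_iSup_right]
    refine iSup₂_le fun s hs => commSub_superProd_le hL (hL.stable _ hL₁) hs.1.1.1
      fun pre t post est => ?_
    have hge : ∀ t ∈ s, v₂ ++ w ≤ t := fun t ht => hs.1.2.2 t ht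
    have hge' : ∀ t ∈ s, x ≤ t := fun t ht =>
      (hx ▸ append_lt_append hext.lt (by simp) w w).le.trans (hge t ht)
    have ht : t ∈ s := est ▸ (by simp)
    have hxt : x ≤ v₁ ++ t := by
      rw [← hx, List.append_assoc]; exact append_le_append_left v₁ (hge t ht)
    have h₁t : v₁ < t := (h₁₂.trans_le (le_append v₂ w)).trans_le (hge t ht)
    have hLs := hs.1.1.1
    have hlen_s : pre.flatten.length + t.length + post.flatten.length = v₂.length + w.length := by
      rw [← hs.2, est]; simp; omega
    have key : commSub k H A (L v₁) (L t) ≤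
        superSpan L (monotonicInLength (Set.Ici (v₁ ++ t)) (v₁.length + t.length)) := by
      by_cases hc : v₁.length + t.length < N
      · exact ihN' hL₁ (hLs t ht) h₁t hc
      · have hN' : v₁.length + t.length = N := by omega
        -- When v₁t = x the two outer inductions give nothing, but v₁ is shorter than v, so the
        -- innermost one applies.
        rcases hxt.eq_or_lt with h | h
        · exact ihm v₁.length (by omega) hL₁ (hLs t ht) h₁t hN' h.symm rfl
        · exact ihx' hL₁ (hLs t ht) h₁t hN' h
    refine (mul_le_mul' (mul_le_mul' le_rfl key) le_rfl).trans (mul_superSpan_mul_le fun s' hs' => ?_)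
    rw [← superProd_append, ← superProd_append]
    refine hstr _ (by simp [hs'.1.2.1]) (fun z hz => ?_) ?_
    · simp only [List.mem_append] at hz
      rcases hz with (hz | hz) | hz
      · have : z ∈ s := est ▸ (by simp [hz])
        exact ⟨hLs z this, hge' z this⟩
      · exact ⟨hs'.1.1.1 z hz, hxt.trans (hs'.1.2.2 z hz)⟩
      · have : z ∈ s := est ▸ (by simp [hz])
        exact ⟨hLs z this, hge' z this⟩
    · rw [List.flatten_append, List.flatten_append, List.length_append, List.length_append, hs'.2]
      omega
  -- The term [v₁, w] v₂, whose letters are ≥ v₁w or equal to v₂. Both are ≥ x: the first since v₂w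
  -- < w, the second since v₂ is a proper suffix of the Lyndon word v.
  · have h := mul_superSpan_mul_le (L := L) (X := 1) (Y := L v₂)
      (R := superSpan L (monotonicInLength (Set.Ici x) N))
      (S := monotonicInLength (Set.Ici (v₁ ++ w)) (v₁.length + w.length)) fun s hs => by
        rw [one_mul, ← superProd_singleton L v₂, ← superProd_append]
        refine hstr _ (by simp) (fun z hz => ?_) ?_
        · rcases List.mem_append.mp hz with hz | hz
          · exact ⟨hs.1.1.1 z hz, hx₁w.trans (hs.1.2.2 z hz)⟩
          · rw [List.mem_singleton.mp hz]; exact ⟨hL₂, hx₂⟩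
        · rw [List.flatten_append, List.length_append, hs.2]; simp; omega
    rw [one_mul] at h
    exact (mul_le_mul' hv₁w le_rfl).trans h
  · have h := mul_superSpan_mul_le (L := L) (X := L v₂) (Y := 1)
      (R := superSpan L (monotonicInLength (Set.Ici x) N))
      (S := monotonicInLength (Set.Ici (v₁ ++ w)) (v₁.length + w.length)) fun s hs => by
        rw [mul_one, ← superProd_cons]
        refine hstr _ (by simp) (fun z hz => ?_) ?_
        · rcases List.mem_cons.mp hz with rfl | hz
          · exact ⟨hL₂, hx₂⟩
          · exact ⟨hs.1.1.1 z hz, hx₁w.trans (hs.1.2.2 z hz)⟩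
        · rw [List.flatten_cons, List.length_append, hs.2]; omega
    rw [mul_one] at h
    exact (mul_le_mul' le_rfl hv₁w).trans h

/-- The commutator condition of `superProd_le_of_commSub_le` now holds without restriction on
lengths, so sorting never leaves an upper set of letters. -/
theorem superProd_le_superSpan_of_isUpperSet {L : List α → Submodule k A}
    (hL : IsLyndonFamily H L) {P : Set (List α)} (hP : IsUpperSet P) {s : List (List α)}
    (hne : s ≠ []) (hs : ∀ v ∈ s, IsLyndon v ∧ v ∈ P) :
    superProd L s ≤ superSpan L (monotonicIn P) :=
  (superProd_le_of_commSub_le hL hP _ (fun _ _ ha hb hab _ _ => commSub_le_superSpan hL ha hb hab)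
    hne hs le_rfl).trans (superSpan_mono L (monotonicInLength_subset _ _))

/-- Monotonic words in letters from an upper set span a (nonunital) subalgebra. -/
theorem superSpan_mul_self_le {L : List α → Submodule k A} (hL : IsLyndonFamily H L)
    {P : Set (List α)} (hP : IsUpperSet P) : superSpan L (monotonicIn P) *
      superSpan L (monotonicIn P) ≤ superSpan L (monotonicIn P) := by
  refine superSpan_mul_superSpan_le fun s hs s' hs' =>
    superProd_le_superSpan_of_isUpperSet hL hP (by simp [hs.2.1]) fun v hv => ?_
  rcases List.mem_append.mp hv with hv | hv
  · exact ⟨hs.1.1 v hv, hs.2.2 v hv⟩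
  · exact ⟨hs'.1.1 v hv, hs'.2.2 v hv⟩

theorem isUpperSet_extLT (u : List α) : IsUpperSet {z | ExtLT u z} :=
  fun _ _ h hz => ExtLT.trans_le hz h

/-- By Leibniz, v is commuted with one letter t at a time, giving letters ≥ vt; and wa < t for all a
implies vwa < vt. The untouched letters exceed w, which itself exceeds every vwa since w is a proper
suffix of the Lyndon word vw. -/
theorem commSub_superSpan_extLT_le {L : List α → Submodule k A} (hL : IsLyndonFamily H L)
    {v w : List α} (hv : IsLyndon v) (hw : IsLyndon w) (hvw : v < w) :
    commSub k H A (L v) (superSpan L (monotonicIn {z | ExtLT w z})) ≤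
      superSpan L (monotonicIn {z | ExtLT (v ++ w) z}) := by
  rw [superSpan, commSub_iSup_right]
  simp only [commSub_iSup_right]
  refine iSup₂_le fun s hs => commSub_superProd_le hL (hL.stable _ hv) hs.1.1
    fun pre t post est => ?_
  have hmem : ∀ z ∈ s, IsLyndon z ∧ ExtLT (v ++ w) z := fun z hz =>
    ⟨hs.1.1 z hz, ((hv.append hw hvw).extLT hv.1 hw.1).trans_le (hs.2.2 z hz).lt.le⟩
  have ht : t ∈ s := est ▸ (by simp)
  have hwt : ExtLT w t := hs.2.2 t ht
  refine (mul_le_mul' (mul_le_mul' le_rfl (commSub_le_superSpan hL hv (hs.1.1 t ht)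
    (hvw.trans hwt.lt))) le_rfl).trans (mul_superSpan_mul_le fun s' hs' => ?_)
  rw [← superProd_append, ← superProd_append]
  refine superProd_le_superSpan_of_isUpperSet hL (isUpperSet_extLT _) (by simp [hs'.1.2.1])
    fun z hz => ?_
  simp only [List.mem_append] at hz
  rcases hz with (hz | hz) | hz
  · exact hmem z (est ▸ (by simp [hz]))
  · exact ⟨hs'.1.1.1 z hz, (hwt.append_left v).trans_le (hs'.1.2.2 z hz)⟩
  · exact hmem z (est ▸ (by simp [hz]))

end Straightening

/-! ## The reduced coproduct of a braided commutator -/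

section ReducedComul

variable {k H A : Type*} [Field k] [Ring H] [Bialgebra k H] [Ring A] [Algebra k A]
  [ModuleAlgebra k H A] [ComoduleAlgebra k H A]

local notation "inl'" => Smash.inlHom k H A A
local notation "inr'" => Smash.inrHom k H A A

/-- The image of `X ⊗ Y` in the braided tensor square. -/
def smashSub (X Y : Submodule k A) : Submodule k (Smash k H A A) :=
  X.map (inl').toLinearMap * Y.map (inr').toLinearMap

theorem inl_mul_inr_mem_smashSub {X Y : Submodule k A} {x y : A} (hx : x ∈ X) (hy : y ∈ Y) :
    inl' x * inr' y ∈ smashSub X Y :=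
  Submodule.mul_mem_mul (Submodule.mem_map_of_mem hx) (Submodule.mem_map_of_mem hy)

theorem smashSub_le {X Y : Submodule k A} {R : Submodule k (Smash k H A A)} :
    smashSub X Y ≤ R ↔ ∀ x ∈ X, ∀ y ∈ Y, inl' x * inr' y ∈ R := by
  rw [smashSub, Submodule.mul_le]
  constructor
  · exact fun h x hx y hy => h _ (Submodule.mem_map_of_mem hx) _ (Submodule.mem_map_of_mem hy)
  · rintro h _ ⟨x, hx, rfl⟩ _ ⟨y, hy, rfl⟩
    exact h x hx y hy

/-- The reduced coproduct `x ↦ Δ(x) - x ⊗ 1 - 1 ⊗ x`. -/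
def reducedComul (Δ : A →ₐ[k] Smash k H A A) : A →ₗ[k] Smash k H A A :=
  Δ.toLinearMap - (inl').toLinearMap - (inr').toLinearMap

theorem comul_eq (Δ : A →ₐ[k] Smash k H A A) (x : A) :
    Δ x = inl' x + inr' x + reducedComul Δ x := by
  simp [reducedComul]

/-- `h ⊗ s ↦ ((h . a) ⊗ 1) s`. -/
def actMulSmash (a : A) : H ⊗[k] Smash k H A A →ₗ[k] Smash k H A A :=
  TensorProduct.lift (LinearMap.mul k (Smash k H A A) ∘ₗ (inl').toLinearMap ∘ₗ
    (ModuleAlgebra.act (k := k) (H := H) (A := A)).flip a)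

theorem actMulSmash_tmul (a : A) (h : H) (s : Smash k H A A) :
    actMulSmash a (h ⊗ₜ s) = inl' (ModuleAlgebra.act (k := k) h a) * s := rfl

/-- Compares two ways of multiplying s = b ⊗ b' by a: Σ (s₍₋₁₎ . a ⊗ 1) s₍₀₎, with a braided all the
way to the left, and s (a ⊗ 1), where a only passes b'. The difference is one commutator with b,
confined to the left leg. -/
theorem actMulSmash_diagCoact_sub (a b b' : A) :
    actMulSmash a (diagCoact k H A (inl' b * inr' b')) - inl' b * inr' b' * inl' a =
      TensorProduct.lift ((LinearMap.mul k (Smash k H A A)).compl₁₂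
        ((inl').toLinearMap ∘ₗ braidedComm k H A b ∘ₗ
          (ModuleAlgebra.act (k := k) (H := H) (A := A)).flip a) (inr').toLinearMap)
        (LeftComodule.coact b') := by
  rw [diagCoact, Smash.prodMap_mul, coactRight_apply, mul_assoc, inr_mul_inl]
  generalize LeftComodule.coact (k := k) (H := H) b' = t
  induction t with
  | zero => simp
  | add s s' hs hs' => simp only [map_add, mul_add, ← hs, ← hs']; abel
  | tmul h y =>
    have h1 : actMulSmash a (coactLeft k H A b *
        (Smash.inrHom k H A A).toLinearMap.lTensor H (h ⊗ₜ y)) =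
        inl' (mulSmash k H A (inr' b * inl' (ModuleAlgebra.act (k := k) h a))) * inr' y := by
      rw [inr_mul_inl, coactLeft_apply]
      generalize LeftComodule.coact (k := k) (H := H) b = t
      induction t with
      | zero => simp
      | add s s' hs hs' => simp only [map_add, add_mul, hs, hs']
      | tmul g x =>
        simp [actMulSmash_tmul, actTensor_tmul, mulSmash_mul, ModuleAlgebra.mul_act, mul_assoc]
    rw [h1, actTensor_tmul]
    simp [braidedComm_apply, mul_assoc]

theorem actMulSmash_diagCoact_sub_mem {X Y Z R : Submodule k A} (hX : IsStable k H A X)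
    (hZ : IsStable k H A Z) (hR : commSub k H A X Y ≤ R) {a : A} (ha : a ∈ X)
    {s : Smash k H A A} (hs : s ∈ smashSub Y Z) :
    actMulSmash a (diagCoact k H A s) - s * inl' a ∈ smashSub R Z := by
  suffices h : smashSub Y Z ≤ (smashSub R Z).comap
    (actMulSmash a ∘ₗ diagCoact k H A - LinearMap.mulRight k (inl' a)) from h hs
  refine smashSub_le.mpr fun b hb b' hb' => ?_
  change actMulSmash a (diagCoact k H A (inl' b * inr' b')) - inl' b * inr' b' * inl' a ∈
    smashSub R Z
  rw [actMulSmash_diagCoact_sub]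
  exact hZ.map_coact_mem _ (fun h y hy => inl_mul_inr_mem_smashSub
    (hR (braidedComm_mem_commSub (hX.act_mem h a ha) hb)) hy) hb'

theorem inrMap_mul_inlMap_le {X Y : Submodule k A} (hX : IsStable k H A X)
    (hY : IsStable k H A Y) :
    Y.map (inr').toLinearMap * X.map (inl').toLinearMap ≤ smashSub X Y := by
  refine Submodule.mul_le.mpr ?_
  rintro _ ⟨y, hy, rfl⟩ _ ⟨x, hx, rfl⟩
  exact inr_mul_inl_mem hX hY hx hy

theorem map_mul_map_le {B C : Type*} [Ring B] [Algebra k B] [Ring C] [Algebra k C] (f : B →ₐ[k] C)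
    {X : Submodule k B} (hX : X * X ≤ X) :
    X.map f.toLinearMap * X.map f.toLinearMap ≤ X.map f.toLinearMap := by
  rw [← Submodule.map_mul]
  exact Submodule.map_mono hX

/-- The induction step for the coproduct, in abstract form. In the application U = L(v), W = L(w), K
and K' are spanned by the words attached to vw and w, and P = T⁺V. U need not lie in K, so left legs
containing a bare a have to be combined into commutators. -/
theorem reducedComul_braidedComm_mem [IsYDAlgebra k H A] {Δ : A →ₐ[k] Smash k H A A}
    (hΔ : ∀ x, diagCoact k H A (Δ x) = Δ.toLinearMap.lTensor H (LeftComodule.coact x))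
    {U W K K' P : Submodule k A} (hU : IsStable k H A U) (hW : IsStable k H A W)
    (hK : IsStable k H A K) (hP : IsStable k H A P) (hKK : K * K ≤ K) (hPP : P * P ≤ P)
    (hUP : U ≤ P) (hWP : W ≤ P) (hWK : W ≤ K) (hK'K : K' ≤ K) (hUK' : commSub k H A U K' ≤ K)
    (hDU : ∀ a ∈ U, reducedComul Δ a ∈ smashSub K P)
    (hDW : ∀ b ∈ W, reducedComul Δ b ∈ smashSub K' P) {a b : A} (ha : a ∈ U) (hb : b ∈ W) :
    reducedComul Δ (braidedComm k H A b a) ∈ smashSub K P := by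
  set M := smashSub (H := H) K P with hM
  set iK := K.map (inl').toLinearMap with hiK
  set iP := P.map (inr').toLinearMap with hiP
  have hMdef : M = iK * iP := rfl
  -- Stability lets right legs be braided past left legs, so K ⊗ P is closed under multiplication
  -- and under multiplication by K ⊗ 1 and 1 ⊗ P on either side.
  have hPK : iP * iK ≤ M := inrMap_mul_inlMap_le hK hP
  have hKK' : iK * iK ≤ iK := map_mul_map_le _ hKK
  have hPP' : iP * iP ≤ iP := map_mul_map_le _ hPP
  have hKM : iK * M ≤ M := by
    rw [hMdef, ← mul_assoc]; exact mul_le_mul' hKK' le_rfl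
  have hMP : M * iP ≤ M := by
    rw [hMdef, mul_assoc]; exact mul_le_mul' le_rfl hPP'
  have hPM : iP * M ≤ M := by
    rw [hMdef, ← mul_assoc]; exact (mul_le_mul' hPK le_rfl).trans hMP
  have hMK : M * iK ≤ M := by
    rw [hMdef, mul_assoc]; exact (mul_le_mul' le_rfl hPK).trans hKM
  have hMM : M * M ≤ M := by
    conv_lhs => rw [hMdef, mul_assoc]
    exact (mul_le_mul' le_rfl hPM).trans hKM
  have hDW' : ∀ y ∈ W, reducedComul Δ y ∈ M := fun y hy =>
    mul_le_mul' (Submodule.map_mono hK'K) le_rfl (hDW y hy)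
  have hlK : ∀ y ∈ W, inl' y ∈ iK := fun y hy => Submodule.mem_map_of_mem (hWK hy)
  have hrW : ∀ y ∈ W, inr' y ∈ iP := fun y hy => Submodule.mem_map_of_mem (hWP hy)
  have hrU : ∀ x ∈ U, inr' x ∈ iP := fun x hx => Submodule.mem_map_of_mem (hUP hx)
  -- On h ⊗ y, with a' = h . a, this is D(a'y) without its two terms in which a' ⊗ 1 multiplies from
  -- the left, namely a' ⊗ y and (a' ⊗ 1)D(y). All that is left lies in K ⊗ P.
  let F : H ⊗[k] A →ₗ[k] Smash k H A A :=
    reducedComul Δ ∘ₗ mulSmash k H A ∘ₗ actTensor a - actTensor a -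
      actMulSmash a ∘ₗ (reducedComul Δ).lTensor H
  have hF : F (LeftComodule.coact b) ∈ M := by
    refine hW.map_coact_mem F (fun h y hy => ?_) hb
    have ha' := hU.act_mem h a ha
    have e : F (h ⊗ₜ y) = inr' (ModuleAlgebra.act (k := k) h a) * inl' y +
        inr' (ModuleAlgebra.act (k := k) h a) * reducedComul Δ y +
        reducedComul Δ (ModuleAlgebra.act (k := k) h a) * inl' y +
        reducedComul Δ (ModuleAlgebra.act (k := k) h a) * inr' y +
        reducedComul Δ (ModuleAlgebra.act (k := k) h a) * reducedComul Δ y := by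
      have h1 := comul_eq Δ (ModuleAlgebra.act (k := k) h a * y)
      rw [map_mul Δ, comul_eq Δ y, comul_eq Δ (ModuleAlgebra.act (k := k) h a),
        map_mul (inl'), map_mul (inr')] at h1
      simp only [F, LinearMap.sub_apply, LinearMap.comp_apply, LinearMap.lTensor_tmul,
        actTensor_tmul, mulSmash_mul, actMulSmash_tmul]
      rw [← sub_eq_iff_eq_add'] at h1
      rw [← h1]
      noncomm_ring
    rw [e]
    refine add_mem (add_mem (add_mem (add_mem ?_ ?_) ?_) ?_) ?_
    · exact hPK (Submodule.mul_mem_mul (hrU _ ha') (hlK y hy))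
    · exact hPM (Submodule.mul_mem_mul (hrU _ ha') (hDW' y hy))
    · exact hMK (Submodule.mul_mem_mul (hDU _ ha') (hlK y hy))
    · exact hMP (Submodule.mul_mem_mul (hDU _ ha') (hrW y hy))
    · exact hMM (Submodule.mul_mem_mul (hDU _ ha') (hDW' y hy))
  -- Colinearity of Δ: the omitted terms (b₍₋₁₎ . a ⊗ 1) D(b₍₀₎) depend only on the diagonal
  -- coaction of D(b), so they can be compared with D(b)(a ⊗ 1).
  have hD : (reducedComul Δ).lTensor H (LeftComodule.coact b) =
      diagCoact k H A (reducedComul Δ b) := by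
    have h1 : diagCoact k H A (inl' b) = (inl').toLinearMap.lTensor H (LeftComodule.coact b) :=
      Smash.prodMap_inl _ _ b
    have h2 : diagCoact k H A (inr' b) = (inr').toLinearMap.lTensor H (LeftComodule.coact b) :=
      Smash.prodMap_inr _ _ b
    simp only [reducedComul, LinearMap.lTensor_sub, LinearMap.sub_apply, map_sub,
      AlgHom.toLinearMap_apply, hΔ, h1, h2]
  have hG := actMulSmash_diagCoact_sub_mem hU hP hUK' ha (hDW b hb)
  -- The omitted a' ⊗ b' terms, that is c(b ⊗ a), cancel against (1 ⊗ b)(a ⊗ 1) from the expansion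
  -- of D(ba).
  have e : reducedComul Δ (braidedComm k H A b a) = F (LeftComodule.coact b) +
      (actMulSmash a (diagCoact k H A (reducedComul Δ b)) - reducedComul Δ b * inl' a) -
      (inl' b * inr' a + inl' b * reducedComul Δ a + inr' b * reducedComul Δ a +
        reducedComul Δ b * inr' a + reducedComul Δ b * reducedComul Δ a) := by
    have h1 := comul_eq Δ (b * a)
    rw [map_mul Δ, comul_eq Δ b, comul_eq Δ a, map_mul (inl'), map_mul (inr')] at h1
    rw [← sub_eq_iff_eq_add'] at h1
    simp only [F, LinearMap.sub_apply, LinearMap.comp_apply, hD, ← inr_mul_inl]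
    rw [braidedComm_apply, map_sub, ← h1]
    noncomm_ring
  rw [e]
  refine sub_mem (add_mem hF hG) (add_mem (add_mem (add_mem (add_mem ?_ ?_) ?_) ?_) ?_)
  · exact Submodule.mul_mem_mul (hlK b hb) (hrU a ha)
  · exact hKM (Submodule.mul_mem_mul (hlK b hb) (hDU a ha))
  · exact hPM (Submodule.mul_mem_mul (hrW b hb) (hDU a ha))
  · exact hMP (Submodule.mul_mem_mul (hDW' b hb) (hrU a ha))
  · exact hMM (Submodule.mul_mem_mul (hDW' b hb) (hDU a ha))

end ReducedComul

/-! ## Bracket letters and words in the tensor algebra -/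

section BracketLetters

variable {k H V : Type*} [Field k] [Ring H] [HopfAlgebra k H] [AddCommGroup V] [Module k V]
  [Module H V] [IsScalarTower k H V] [YetterDrinfeldModule k H V]
  (hS : Function.Bijective (HopfAlgebra.antipode k : H →ₗ[k] H))

local notation "T" => TensorAlgebra k V
local notation "ι'" => TensorAlgebra.ι k

theorem braidMap_tmul (b a : T) : Smash.ofTensor k H T T (braidMap k H V (b ⊗ₜ a)) =
    Smash.inrHom k H T T b * Smash.inlHom k H T T a := by
  rw [Smash.inrHom_mul_inlHom]
  rfl

theorem mul_braidMap (t : T ⊗[k] T) : LinearMap.mul' k T (braidMap k H V t) =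
    LinearMap.mul' k T t + TensorProduct.lift (braidedComm k H T) t := by
  induction t with
  | zero => simp
  | add s s' hs hs' => simp only [map_add, hs, hs']; abel
  | tmul b a =>
    have h : mulSmash k H T (Smash.ofTensor k H T T (braidMap k H V (b ⊗ₜ a))) =
        LinearMap.mul' k T (braidMap k H V (b ⊗ₜ a)) := by
      generalize braidMap k H V (b ⊗ₜ a) = t
      induction t with
      | zero => simp
      | add s s' hs hs' => simp only [map_add, hs, hs']
      | tmul b a => rw [← Smash.inlHom_mul_inrHom, mulSmash_mul, LinearMap.mul'_apply]
    rw [TensorProduct.lift.tmul, braidedComm_apply, ← braidMap_tmul, h, LinearMap.mul'_apply]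
    abel

/-- Substituting c(t) removes the inverse: [c(t)] = m c(t) - m(t). -/
theorem bracket_braidMap (t : T ⊗[k] T) :
    bracket V hS (braidMap k H V t) = TensorProduct.lift (braidedComm k H T) t := by
  have h : (braiding V hS).symm (braidMap k H V t) = t := (braiding V hS).symm_apply_apply t
  rw [bracket, LinearMap.sub_apply, LinearMap.comp_apply, LinearEquiv.coe_coe, h, mul_braidMap]
  abel

/-- The braiding maps `Y ⊗ X` onto `X ⊗ Y` if `X` and `Y` are stable. -/
theorem map_braidMap (hS : Function.Bijective (HopfAlgebra.antipode k : H →ₗ[k] H))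
    {X Y : Submodule k T} (hX : IsStable k H T X) (hY : IsStable k H T Y) :
    (Submodule.map₂ (TensorProduct.mk k T T) Y X).map (braidMap k H V) =
      Submodule.map₂ (TensorProduct.mk k T T) X Y := by
  apply le_antisymm
  · rw [Submodule.map_le_iff_le_comap, Submodule.map₂_le]
    intro y hy x hx
    change (((ModuleAlgebra.act (k := k) (H := H) (A := T)).flip x).rTensor T)
      (LeftComodule.coact (k := k) (H := H) y) ∈ Submodule.map₂ (TensorProduct.mk k T T) X Y
    exact hY.map_coact_mem _ (fun h y' hy' =>
      Submodule.apply_mem_map₂ (TensorProduct.mk k T T) (hX.act_mem h x hx) hy') hy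
  · rw [Submodule.map₂_le]
    intro x hx y hy
    refine ⟨braidInvMap k H V (antipodeInv hS) (x ⊗ₜ y), ?_,
      LinearMap.congr_fun (braidMap_braidInvMap hS) _⟩
    exact hY.map_coact_mem ((TensorProduct.comm k T T).toLinearMap ∘ₗ (((ModuleAlgebra.act (k := k) (H := H)
      (A := T)) ∘ₗ antipodeInv hS).flip x).rTensor T) (fun h y' hy' =>
      Submodule.apply_mem_map₂ (TensorProduct.mk k T T) hy' (hX.act_mem _ x hx)) hy

theorem map_bracket {X Y : Submodule k T} (hX : IsStable k H T X) (hY : IsStable k H T Y) :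
    (Submodule.map₂ (TensorProduct.mk k T T) X Y).map (bracket V hS) = commSub k H T X Y := by
  rw [← map_braidMap hS hX hY, ← Submodule.map_comp]
  have : bracket V hS ∘ₗ braidMap k H V = TensorProduct.lift (braidedComm k H T) :=
    LinearMap.ext (bracket_braidMap hS)
  rw [this, Submodule.map_map₂]
  rfl

theorem mul_eq_map_mul' (X Y : Submodule k T) : X * Y =
    (Submodule.map₂ (TensorProduct.mk k T T) X Y).map (LinearMap.mul' k T) := by
  refine le_antisymm (Submodule.mul_le.mpr fun x hx y hy =>
    ⟨x ⊗ₜ y, Submodule.apply_mem_map₂ (TensorProduct.mk k T T) hx hy, rfl⟩) ?_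
  rw [Submodule.map_le_iff_le_comap, Submodule.map₂_le]
  exact fun x hx y hy => Submodule.mul_mem_mul hx hy

/-- Since c maps Y ⊗ X onto X ⊗ Y, every product from X * Y has the form m c(t) with t in Y ⊗ X,
that is m(t) plus a commutator. This is the exchange step of the sorting. -/
theorem mul_le_mul_sup_commSub (hS : Function.Bijective (HopfAlgebra.antipode k : H →ₗ[k] H))
    {X Y : Submodule k T} (hX : IsStable k H T X)
    (hY : IsStable k H T Y) : X * Y ≤ Y * X ⊔ commSub k H T X Y := by
  rw [mul_eq_map_mul' X Y, ← map_braidMap hS hX hY, ← Submodule.map_comp, Submodule.map_le_iff_le_comap,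
    Submodule.map₂_le]
  intro y hy x hx
  rw [Submodule.mem_comap, LinearMap.comp_apply, mul_braidMap]
  exact Submodule.add_mem_sup (Submodule.mul_mem_mul hy hx) (braidedComm_mem_commSub hx hy)

/-! ### The stable subspaces `T⁺V` and `V_a` -/

theorem isStable_map_ι {W : Submodule k V} (hW : IsYDSubmodule k H W) :
    IsStable k H T (W.map (TensorAlgebra.ι k)) where
  act_mem := by
    rintro h _ ⟨v, hv, rfl⟩
    rw [act_ι]
    exact Submodule.mem_map_of_mem (hW.1 h v hv)
  coact_mem := by
    rintro _ ⟨v, hv, rfl⟩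
    rw [coact_ι]
    obtain ⟨t, ht⟩ := hW.2 v hv
    rw [← ht]
    clear ht
    induction t with
    | zero => simp
    | add s s' hs hs' => simp only [map_add]; exact add_mem hs hs'
    | tmul g w => exact tmul_mem_tensorSub g (Submodule.mem_map_of_mem w.2)

theorem isStable_range_ι :
    IsStable k H T (LinearMap.range (TensorAlgebra.ι k : V →ₗ[k] T)) := by
  rw [LinearMap.range_eq_map]
  refine isStable_map_ι ⟨fun _ _ _ => Submodule.mem_top, fun v _ => ?_⟩
  rw [LinearMap.range_eq_top.mpr (LinearMap.lTensor_surjective H fun x => ⟨⟨x, trivial⟩, rfl⟩)]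
  exact Submodule.mem_top

theorem isStable_tensorPlus : IsStable k H T (tensorPlus k V) := by
  refine .iSup fun n => ?_
  induction n with
  | zero => simpa using isStable_range_ι
  | succ n ih => rw [pow_succ]; exact ih.mul isStable_range_ι

theorem tensorPlus_mul_self_le : tensorPlus k V * tensorPlus k V ≤ tensorPlus k V := by
  simp only [tensorPlus, Submodule.mul_iSup, Submodule.iSup_mul]
  refine iSup_le fun m => iSup_le fun n => ?_
  rw [← pow_add, show n + 1 + (m + 1) = (n + m + 1) + 1 by ring]
  exact le_iSup (fun n => LinearMap.range (TensorAlgebra.ι k : V →ₗ[k] T) ^ (n + 1)) _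

theorem ι_mem_tensorPlus (v : V) : ι' v ∈ tensorPlus k V := by
  refine Submodule.mem_iSup_of_mem 0 ?_
  rw [zero_add, pow_one]
  exact LinearMap.mem_range_self _ v

theorem commSub_le_mul_sup {X Y : Submodule k T} (hX : IsStable k H T X)
    (hY : IsStable k H T Y) : commSub k H T X Y ≤ X * Y ⊔ Y * X := by
  refine Submodule.map₂_le.mpr fun y hy x hx => ?_
  rw [braidedComm_apply]
  refine sub_mem (Submodule.mem_sup_left ?_)
    (Submodule.mem_sup_right (Submodule.mul_mem_mul hy hx))
  rw [inr_mul_inl]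
  refine hY.map_coact_mem (mulSmash k H T ∘ₗ actTensor x) (fun h y' hy' => ?_) hy
  rw [LinearMap.comp_apply, actTensor_tmul, mulSmash_mul]
  exact Submodule.mul_mem_mul (hX.act_mem h x hx) hy'

/-! ### Spaces of bracket letters and bracket words -/

variable {A : Type*} [LinearOrder A] (Vc : A → Submodule k V)

theorem mulEquiv_tprod_tmul_tprod {m n : ℕ} (x : Fin m → V) (y : Fin n → V) :
    TensorPower.mulEquiv (PiTensorProduct.tprod k x ⊗ₜ PiTensorProduct.tprod k y) =
      PiTensorProduct.tprod k (Fin.append x y) :=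
  TensorPower.tprod_mul_tprod k x y

/-- V^{vw} is V^v ⊗ V^w under concatenation of tensors; checked on pure tensors, which span all
three spaces. -/
theorem map_cast_wordSpace (v w : List A) (h : (v ++ w).length = v.length + w.length) :
    (wordSpace Vc (v ++ w)).map (TensorPower.cast k V h).toLinearMap =
      (Submodule.map₂ (TensorProduct.mk k _ _) (wordSpace Vc v) (wordSpace Vc w)).map
        TensorPower.mulEquiv.toLinearMap := by
  rw [wordSpace, wordSpace, wordSpace, Submodule.map₂_span_span, Submodule.map_span,
    Submodule.map_span]
  congr 1
  ext z
  constructor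
  · rintro ⟨_, ⟨x, hx, rfl⟩, rfl⟩
    let y : Fin (v.length + w.length) → V := x ∘ Fin.cast h.symm
    refine ⟨_, ⟨_, ⟨fun i => y (Fin.castAdd _ i), fun i => ?_, rfl⟩, _,
      ⟨fun i => y (Fin.natAdd _ i), fun i => ?_, rfl⟩, rfl⟩, ?_⟩
    · have := hx (Fin.cast h.symm (Fin.castAdd _ i))
      simpa [y] using this
    · have := hx (Fin.cast h.symm (Fin.natAdd _ i))
      simpa [y] using this
    · refine (mulEquiv_tprod_tmul_tprod _ _).trans ?_
      rw [LinearEquiv.coe_coe, TensorPower.cast_tprod]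
      congr 1
      exact Fin.append_castAdd_natAdd
  · rintro ⟨_, ⟨_, ⟨x, hx, rfl⟩, _, ⟨y, hy, rfl⟩, rfl⟩, rfl⟩
    refine ⟨_, ⟨Fin.append x y ∘ Fin.cast h, fun i => ?_, rfl⟩, ?_⟩
    · obtain ⟨j, rfl⟩ : ∃ j, i = Fin.cast h.symm j := ⟨Fin.cast h i, by simp⟩
      refine Fin.addCases (fun j => ?_) (fun j => ?_) j
      · simpa using hx j
      · simpa using hy j
    · refine Eq.trans ?_ (mulEquiv_tprod_tmul_tprod _ _).symm
      rw [LinearEquiv.coe_coe, TensorPower.cast_tprod]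
      congr 1

theorem map_split_wordSpace {u v w : List A} (e : u = v ++ w)
    (h : u.length = v.length + w.length) :
    (wordSpace Vc u).map (TensorPower.mulEquiv.symm.toLinearMap ∘ₗ
      (TensorPower.cast k V h).toLinearMap) =
      Submodule.map₂ (TensorProduct.mk k _ _) (wordSpace Vc v) (wordSpace Vc w) := by
  subst e
  rw [Submodule.map_comp, map_cast_wordSpace, ← Submodule.map_comp]
  have : (TensorPower.mulEquiv (R := k) (M := V) (n := v.length) (m := w.length)).symm.toLinearMap
    ∘ₗ TensorPower.mulEquiv.toLinearMap = LinearMap.id := by ext; simp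
  rw [this, Submodule.map_id]

theorem map_map_mk {M N M' N' : Type*} [AddCommGroup M] [Module k M] [AddCommGroup N] [Module k N]
    [AddCommGroup M'] [Module k M'] [AddCommGroup N'] [Module k N'] (f : M →ₗ[k] M')
    (g : N →ₗ[k] N') (X : Submodule k M) (Y : Submodule k N) :
    (Submodule.map₂ (TensorProduct.mk k M N) X Y).map (TensorProduct.map f g) =
      Submodule.map₂ (TensorProduct.mk k M' N') (X.map f) (Y.map g) := by
  rw [Submodule.map_map₂, Submodule.map₂_map_map]
  rfl

/-- The space of `u`-bracket letters. -/
def letterSpace (u : List A) : Submodule k T := (wordSpace Vc u).map (letterBracket V hS u)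

theorem letterSpace_singleton (a : A) :
    letterSpace hS Vc [a] = (Vc a).map (TensorAlgebra.ι k) := by
  rw [letterSpace, letterBracket, dif_pos (by simp), wordSpace, Submodule.map_span]
  apply le_antisymm
  · rw [Submodule.span_le]
    rintro _ ⟨_, ⟨x, hx, rfl⟩, rfl⟩
    rw [TensorPower.toTensorAlgebra_tprod, TensorAlgebra.tprod_apply]
    exact ⟨x 0, hx 0, by simp⟩
  · rintro _ ⟨v, hv, rfl⟩
    refine Submodule.subset_span ⟨_, ⟨fun _ => v, fun i => ?_, rfl⟩, ?_⟩
    · simpa using hv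
    · rw [TensorPower.toTensorAlgebra_tprod, TensorAlgebra.tprod_apply]
      simp

theorem letterSpace_eq_map_bracket {u : List A} (hu : ¬ u.length ≤ 1) :
    letterSpace hS Vc u = (Submodule.map₂ (TensorProduct.mk k T T)
      (letterSpace hS Vc (u.take (shirshovIndex u)))
      (letterSpace hS Vc (u.drop (shirshovIndex u)))).map (bracket V hS) := by
  rw [letterSpace, letterBracket, dif_neg hu, Submodule.map_comp, Submodule.map_comp,
    map_split_wordSpace Vc (List.take_append_drop _ _).symm, map_map_mk]
  rfl

variable {Vc}

theorem isStable_letterSpace (hVc : ∀ i, IsYDSubmodule k H (Vc i)) {u : List A} (hu : u ≠ []) :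
    IsStable k H T (letterSpace hS Vc u) := by
  obtain ⟨n, hn⟩ : ∃ n, u.length = n := ⟨_, rfl⟩
  induction n using Nat.strong_induction_on generalizing u with
  | _ n ih =>
  have hpos := List.length_pos_iff.mpr hu
  by_cases h1 : u.length ≤ 1
  · obtain ⟨a, rfl⟩ := List.length_eq_one_iff.mp (le_antisymm h1 hpos)
    rw [letterSpace_singleton]
    exact isStable_map_ι (hVc a)
  · have hs := shirshovIndex_spec h1
    have h2 := ih _ (by rw [List.length_take]; omega)
      (u := u.take (shirshovIndex u)) (List.length_pos_iff.mp (by rw [List.length_take]; omega)) rfl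
    have h3 := ih _ (by rw [List.length_drop]; omega)
      (u := u.drop (shirshovIndex u)) (List.length_pos_iff.mp (by rw [List.length_drop]; omega)) rfl
    rw [letterSpace_eq_map_bracket hS Vc h1, map_bracket hS h2 h3]
    exact h2.commSub h3

theorem letterSpace_eq_commSub (hVc : ∀ i, IsYDSubmodule k H (Vc i)) {u : List A}
    (hu : ¬ u.length ≤ 1) : letterSpace hS Vc u =
      commSub k H T (letterSpace hS Vc (u.take (shirshovIndex u)))
        (letterSpace hS Vc (u.drop (shirshovIndex u))) := by
  have hs := shirshovIndex_spec hu
  rw [letterSpace_eq_map_bracket hS Vc hu, map_bracket hS]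
  · exact isStable_letterSpace hS hVc (List.length_pos_iff.mp (by rw [List.length_take]; omega))
  · exact isStable_letterSpace hS hVc (List.length_pos_iff.mp (by rw [List.length_drop]; omega))

theorem isLyndonFamily_letterSpace (hVc : ∀ i, IsYDSubmodule k H (Vc i)) :
    IsLyndonFamily H (letterSpace hS Vc) where
  stable _ hu := isStable_letterSpace hS hVc hu.1
  commSub_eq v w hv hw _ hi := by
    have h1 := List.length_pos_iff.mpr hv.1
    have h2 := List.length_pos_iff.mpr hw.1
    rw [letterSpace_eq_commSub hS hVc (u := v ++ w) (by rw [List.length_append]; omega), hi,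
      List.take_left, List.drop_left]
  mul_le v w hv hw := mul_le_mul_sup_commSub hS (isStable_letterSpace hS hVc hv.1)
    (isStable_letterSpace hS hVc hw.1)

theorem letterSpace_le_tensorPlus (hVc : ∀ i, IsYDSubmodule k H (Vc i)) {u : List A}
    (hu : u ≠ []) : letterSpace hS Vc u ≤ tensorPlus k V := by
  obtain ⟨n, hn⟩ : ∃ n, u.length = n := ⟨_, rfl⟩
  induction n using Nat.strong_induction_on generalizing u with
  | _ n ih =>
  have hpos := List.length_pos_iff.mpr hu
  by_cases h1 : u.length ≤ 1
  · obtain ⟨a, rfl⟩ := List.length_eq_one_iff.mp (le_antisymm h1 hpos)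
    rw [letterSpace_singleton]
    rintro _ ⟨v, -, rfl⟩
    exact ι_mem_tensorPlus v
  · have hs := shirshovIndex_spec h1
    have n2 : u.take (shirshovIndex u) ≠ [] :=
      List.length_pos_iff.mp (by rw [List.length_take]; omega)
    have n3 : u.drop (shirshovIndex u) ≠ [] :=
      List.length_pos_iff.mp (by rw [List.length_drop]; omega)
    have h2 := ih _ (by rw [List.length_take]; omega) n2 rfl
    have h3 := ih _ (by rw [List.length_drop]; omega) n3 rfl
    rw [letterSpace_eq_commSub hS hVc h1]
    exact (commSub_le_mul_sup (isStable_letterSpace hS hVc n2)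
      (isStable_letterSpace hS hVc n3)).trans (sup_le
        ((mul_le_mul' h2 h3).trans tensorPlus_mul_self_le)
        ((mul_le_mul' h3 h2).trans tensorPlus_mul_self_le))

variable (Vc) in
theorem map_wordBracket (s : List (List A)) :
    (wordSpace Vc s.flatten).map (wordBracket V hS s) = superProd (letterSpace hS Vc) s := by
  induction s with
  | nil =>
    rw [wordBracket, superProd_nil, wordSpace, Submodule.map_span, Submodule.one_eq_span]
    congr 1
    ext z
    constructor
    · rintro ⟨_, ⟨x, hx, rfl⟩, rfl⟩
      rw [TensorPower.toTensorAlgebra_tprod, TensorAlgebra.tprod_apply]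
      simp
    · rintro rfl
      refine ⟨_, ⟨fun _ => 0, fun i => zero_mem _, rfl⟩, ?_⟩
      rw [TensorPower.toTensorAlgebra_tprod, TensorAlgebra.tprod_apply]
      simp
  | cons v s ih =>
    rw [wordBracket, superProd_cons, Submodule.map_comp, Submodule.map_comp,
      map_split_wordSpace Vc (List.flatten_cons), map_map_mk, ih, ← mul_eq_map_mul']
    rfl

theorem superProd_letterSpace_le_tensorPlus (hVc : ∀ i, IsYDSubmodule k H (Vc i))
    {s : List (List A)} (hne : s ≠ []) (hs : ∀ v ∈ s, v ≠ []) :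
    superProd (letterSpace hS Vc) s ≤ tensorPlus k V := by
  induction s with
  | nil => exact absurd rfl hne
  | cons v s ih =>
    have hv := letterSpace_le_tensorPlus hS hVc (hs v (by simp))
    by_cases h : s = []
    · rw [h, superProd_singleton]; exact hv
    · rw [superProd_cons]
      exact (mul_le_mul' hv (ih h fun w hw => hs w (by simp [hw]))).trans tensorPlus_mul_self_le

/-! ### The coproduct -/

theorem braidedComul_ι (v : V) : braidedComul k H V (ι' v) =
    Smash.inlHom k H T T (ι' v) + Smash.inrHom k H T T (ι' v) := by
  rw [braidedComul, TensorAlgebra.lift_ι_apply]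
  rfl

/-- Both sides are algebra morphisms in x, the left one because the diagonal coaction is
multiplicative, so it is enough to compare them on V. -/
theorem diagCoact_braidedComul (x : T) : diagCoact k H T (braidedComul k H V x) =
    (braidedComul k H V).toLinearMap.lTensor H (LeftComodule.coact x) := by
  have key : (diagCoactHom k H T).comp (braidedComul k H V) =
      (Algebra.TensorProduct.map (AlgHom.id k H) (braidedComul k H V)).comp (coactHom k H T) := by
    refine TensorAlgebra.hom_ext (LinearMap.ext fun v => ?_)
    change diagCoact k H T (braidedComul k H V (ι' v)) =
      (braidedComul k H V).toLinearMap.lTensor H (LeftComodule.coact (ι' v))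
    rw [braidedComul_ι, map_add]
    have h1 : diagCoact k H T (Smash.inlHom k H T T (ι' v)) =
      (Smash.inlHom k H T T).toLinearMap.lTensor H (LeftComodule.coact (ι' v)) :=
      Smash.prodMap_inl _ _ _
    have h2 : diagCoact k H T (Smash.inrHom k H T T (ι' v)) =
      (Smash.inrHom k H T T).toLinearMap.lTensor H (LeftComodule.coact (ι' v)) :=
      Smash.prodMap_inr _ _ _
    rw [h1, h2, coact_ι]
    generalize LeftComodule.coact (k := k) (H := H) v = t
    induction t with
    | zero => simp
    | add s s' hs hs' => simp only [map_add, ← hs, ← hs']; abel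
    | tmul g w => simp [braidedComul_ι, TensorProduct.tmul_add]
  exact DFunLike.congr_fun key x

/-- Induction along Shirshov decompositions, starting from primitive letters of length one. The
bound by `ExtLT` passes from v to vw because every extension of vw also extends v. -/
theorem reducedComul_letterSpace_mem [Finite A] (hVc : ∀ i, IsYDSubmodule k H (Vc i)) {u : List A}
    (hu : IsLyndon u) {x : T} (hx : x ∈ letterSpace hS Vc u) :
    reducedComul (braidedComul k H V) x ∈
      smashSub (superSpan (letterSpace hS Vc) (monotonicIn {z | ExtLT u z})) (tensorPlus k V) := by
  have hL := isLyndonFamily_letterSpace hS hVc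
  obtain ⟨n, hn⟩ : ∃ n, u.length = n := ⟨_, rfl⟩
  induction n using Nat.strong_induction_on generalizing u x with
  | _ n ih =>
  have hpos := List.length_pos_iff.mpr hu.1
  by_cases h1 : u.length ≤ 1
  · obtain ⟨a, rfl⟩ := List.length_eq_one_iff.mp (le_antisymm h1 hpos)
    rw [letterSpace_singleton] at hx
    obtain ⟨v, -, rfl⟩ := hx
    have : reducedComul (braidedComul k H V) (ι' v) = 0 := by
      simp [reducedComul, braidedComul_ι]
    rw [this]
    exact zero_mem _
  have hs := shirshovIndex_spec h1
  have hv := hu.take_shirshovIndex h1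
  have hw := isLyndon_drop_shirshovIndex h1
  rw [letterSpace_eq_commSub hS hVc h1] at hx
  have e := List.take_append_drop (shirshovIndex u) u
  have ihv := fun x => ih (u.take (shirshovIndex u)).length
    (by rw [List.length_take]; omega) hv (x := x)
  have ihw := fun x => ih (u.drop (shirshovIndex u)).length
    (by rw [List.length_drop]; omega) hw (x := x)
  generalize u.take (shirshovIndex u) = v at *
  generalize u.drop (shirshovIndex u) = w at *
  subst e
  have hext : ExtLT (v ++ w) w := hu.extLT hv.1 hw.1
  have hvw : v < w := (lt_append_of_ne_nil v hw.1).trans hext.lt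
  suffices h : commSub k H T (letterSpace hS Vc v) (letterSpace hS Vc w) ≤
      (smashSub (superSpan (letterSpace hS Vc) (monotonicIn {z | ExtLT (v ++ w) z}))
        (tensorPlus k V)).comap (reducedComul (braidedComul k H V)) from h hx
  refine Submodule.map₂_le.mpr fun b hb a ha => ?_
  have hsub : ∀ {y}, (∀ z, ExtLT y z → ExtLT (v ++ w) z) →
      superSpan (letterSpace hS Vc) (monotonicIn {z | ExtLT y z}) ≤
      superSpan (letterSpace hS Vc) (monotonicIn {z | ExtLT (v ++ w) z}) := fun h =>
    superSpan_mono _ (monotonicIn_mono h)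
  refine reducedComul_braidedComm_mem diagCoact_braidedComul (hL.stable v hv) (hL.stable w hw)
    (hL.stable_superSpan _) isStable_tensorPlus (superSpan_mul_self_le hL (isUpperSet_extLT _))
    tensorPlus_mul_self_le (letterSpace_le_tensorPlus hS hVc hv.1)
    (letterSpace_le_tensorPlus hS hVc hw.1) ?_ (hsub fun z hz => hext.trans_le hz.lt.le)
    (commSub_superSpan_extLT_le hL hv hw hvw)
    (fun a ha => mul_le_mul' (Submodule.map_mono (hsub fun z hz => hz.append_right w)) le_rfl
      (ihv a ha rfl)) (fun b hb => ihw b hb rfl) ha hb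
  rw [← superProd_singleton (letterSpace hS Vc) w]
  exact superProd_le_superSpan_of_isUpperSet hL (isUpperSet_extLT _) (by simp)
    (by simpa using ⟨hw, hext⟩)

/-- The map `r ⊗ s ↦ (r # s₍₋₁₎) ⊗ (s₍₀₎ # 1)`, which sends `Δ_{TV}(x)` to the coproduct of
`x # 1`. -/
def bosonize (k H V : Type*) [Field k] [Ring H] [HopfAlgebra k H] [AddCommGroup V] [Module k V]
    [Module H V] [IsScalarTower k H V] [YetterDrinfeldModule k H V] :
    Smash k H (TensorAlgebra k V) (TensorAlgebra k V) →ₗ[k]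
      TensorSmash k H V ⊗[k] TensorSmash k H V :=
  smashComulAux k H V ∘ₗ (TensorProduct.mk k _ (H ⊗[k] H)).flip (1 ⊗ₜ 1) ∘ₗ
    (Smash.ofTensor k H (TensorAlgebra k V) (TensorAlgebra k V)).symm.toLinearMap

theorem smashComul_inl (x : T) : smashComul k H V (Smash.inl k H T H x) =
    bosonize k H V (braidedComul k H V x) := by
  change smashComulAux k H V (_ ⊗ₜ Coalgebra.comul (1 : H)) = _
  rw [Bialgebra.comul_one]
  rfl

theorem bosonize_mul (x y : T) :
    bosonize k H V (Smash.inlHom k H T T x * Smash.inrHom k H T T y) =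
      TensorProduct.map (LinearMap.mulLeft k (Smash.inlHom k H T H x) ∘ₗ Smash.inr k H T H)
        (Smash.inl k H T H) (LeftComodule.coact y) := by
  rw [Smash.inlHom_mul_inrHom]
  change smashComulAux k H V ((x ⊗ₜ y) ⊗ₜ (1 ⊗ₜ 1)) = _
  simp only [smashComulAux, LinearMap.comp_apply, LinearMap.rTensor_tmul, LinearMap.lTensor_tmul]
  generalize LeftComodule.coact (k := k) (H := H) y = t
  induction t with
  | zero => simp
  | add s s' hs hs' =>
    simp only [TensorProduct.tmul_add, TensorProduct.add_tmul, map_add, hs, hs']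
  | tmul g w =>
    rw [TensorProduct.map_tmul, LinearMap.comp_apply, LinearMap.mulLeft_apply,
      ← Smash.inrHom_apply, Smash.inlHom_mul_inrHom]
    simp
    rfl

/-- The terms `X' h ⊗ X''` of the coproduct of a `u`-bracket letter. -/
def comulTerms (Vc : A → Submodule k V) (u : List A) :
    Set (TensorSmash k H V ⊗[k] TensorSmash k H V) :=
  {z | ∃ (w : List (List A)) (X' X'' : T) (h : H), w ∈ MonotonicGT u ∧
    IsBracketWord hS Vc w X' ∧ X' ∈ tensorPlus k V ∧ X'' ∈ tensorPlus k V ∧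
    z = (Smash.inl k H T H X' * Smash.inr k H T H h) ⊗ₜ[k] Smash.inl k H T H X''}

/-- The coaction of the right leg supplies the factor h, and stability of T⁺V keeps s₍₀₎ there. The
left leg stays a combination of products of letter spaces, which consist of bracket words by
`map_wordBracket`. -/
theorem bosonize_mem_span (hVc : ∀ i, IsYDSubmodule k H (Vc i)) {u : List A}
    {s : Smash k H T T} (hs : s ∈ smashSub (superSpan (letterSpace hS Vc)
      (monotonicIn {z | ExtLT u z})) (tensorPlus k V)) :
    bosonize k H V s ∈ Submodule.span k (comulTerms hS Vc u) := by
  suffices h : smashSub (superSpan (letterSpace hS Vc) (monotonicIn {z | ExtLT u z}))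
    (tensorPlus k V) ≤ (Submodule.span k (comulTerms hS Vc u)).comap (bosonize k H V) from h hs
  refine smashSub_le.mpr fun x hx y hy => ?_
  rw [Submodule.mem_comap, bosonize_mul]
  refine isStable_tensorPlus.map_coact_mem _ (fun h y' hy' => ?_) hy
  suffices h : superSpan (letterSpace hS Vc) (monotonicIn {z | ExtLT u z}) ≤
      (Submodule.span k (comulTerms hS Vc u)).comap
        ((TensorProduct.mk k _ _).flip (Smash.inl k H T H y') ∘ₗ
          LinearMap.mulRight k (Smash.inr k H T H h) ∘ₗ Smash.inl k H T H) from h hx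
  refine iSup₂_le fun w hw x hx => Submodule.subset_span ⟨w, x, y', h,
    ⟨hw.1, hw.2.1, fun v hv => (hw.2.2 v hv).lt⟩, ⟨hw.1, ?_⟩,
    superProd_letterSpace_le_tensorPlus hS hVc hw.2.1 (fun v hv => (hw.1.1 v hv).1) hx, hy', rfl⟩
  rw [← map_wordBracket] at hx
  exact hx

/-- The coproduct of a bracket letter. -/
theorem smashComul_letter [Finite A] (hVc : ∀ i, IsYDSubmodule k H (Vc i)) {u : List A} {X : T}
    (hX : IsBracketLetter hS Vc u X) : smashComul k H V (Smash.inl k H T H X) -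
      (Smash.inl k H T H X ⊗ₜ[k] 1 + TensorProduct.map (Smash.inr k H T H) (Smash.inl k H T H)
          (LeftComodule.coact (k := k) (H := H) X)) ∈
      Submodule.span k (comulTerms hS Vc u) := by
  have h1 : bosonize k H V (Smash.inlHom k H T T X) = Smash.inl k H T H X ⊗ₜ[k] 1 := by
    have h := bosonize_mul (k := k) (H := H) X 1
    rw [map_one, mul_one, ComoduleAlgebra.coact_one, Algebra.TensorProduct.one_def,
      TensorProduct.map_tmul, LinearMap.comp_apply, LinearMap.mulLeft_apply, ← Smash.inrHom_apply,
      map_one, mul_one] at h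
    exact h
  have h2 : bosonize k H V (Smash.inrHom k H T T X) = TensorProduct.map (Smash.inr k H T H)
      (Smash.inl k H T H) (LeftComodule.coact (k := k) (H := H) X) := by
    have h := bosonize_mul (k := k) (H := H) 1 X
    rw [map_one, map_one, one_mul, LinearMap.mulLeft_one, LinearMap.id_comp] at h
    exact h
  rw [smashComul_inl, comul_eq, map_add, map_add, h1, h2, add_sub_cancel_left]
  exact bosonize_mem_span hS hVc (reducedComul_letterSpace_mem hS hVc hX.1 hX.2)

end BracketLetters

end

end LyndonHopf

theorem mainTheorem8 {k H V : Type*} [Field k] [Ring H] [HopfAlgebra k H]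
    (hS : Function.Bijective (HopfAlgebra.antipode k : H →ₗ[k] H))
    [AddCommGroup V] [Module k V] [Module H V] [IsScalarTower k H V]
    [LyndonHopf.YetterDrinfeldModule k H V]
    {d : ℕ} (Vc : Fin d → Submodule k V)
    (hVc : ∀ i, LyndonHopf.IsYDSubmodule k H (Vc i))
    (hV : DirectSum.IsInternal Vc)
    (u : List (Fin d)) (X : TensorAlgebra k V)
    (hX : LyndonHopf.IsBracketLetter hS Vc u X) :
    ∃ (n : ℕ) (w : Fin n → List (List (Fin d))) (X' X'' : Fin n → TensorAlgebra k V)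
      (h : Fin n → H),
      (∀ i, w i ∈ LyndonHopf.MonotonicGT u ∧
        LyndonHopf.IsBracketWord hS Vc (w i) (X' i) ∧
        X' i ∈ LyndonHopf.tensorPlus k V ∧ X'' i ∈ LyndonHopf.tensorPlus k V) ∧
      LyndonHopf.smashComul k H V (LyndonHopf.Smash.inl k H (TensorAlgebra k V) H X) =
        LyndonHopf.Smash.inl k H (TensorAlgebra k V) H X ⊗ₜ[k] 1 +
        TensorProduct.map (LyndonHopf.Smash.inr k H (TensorAlgebra k V) H)
          (LyndonHopf.Smash.inl k H (TensorAlgebra k V) H)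
          (LyndonHopf.LeftComodule.coact (k := k) (H := H) X) +
        ∑ i, (LyndonHopf.Smash.inl k H (TensorAlgebra k V) H (X' i) *
            LyndonHopf.Smash.inr k H (TensorAlgebra k V) H (h i)) ⊗ₜ[k]
          LyndonHopf.Smash.inl k H (TensorAlgebra k V) H (X'' i) := by
  have h := LyndonHopf.smashComul_letter hS hVc hX
  obtain ⟨n, f, g, hg⟩ := Submodule.mem_span_set'.mp h
  choose w X' X'' c hw hX' hX'p hX''p e using fun i => (g i).2
  -- The coefficients of the linear combination go into X'; bracket words of a fixed super-word form
  -- a subspace, so they remain bracket words.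
  refine ⟨n, w, fun i => f i • X' i, X'', c, fun i => ⟨hw i, ?_, Submodule.smul_mem _ _ (hX'p i),
    hX''p i⟩, ?_⟩
  · obtain ⟨hm, x, hx, hxe⟩ := hX' i
    exact ⟨hm, f i • x, Submodule.smul_mem _ _ hx, by rw [map_smul, hxe]⟩
  · rw [← sub_eq_iff_eq_add', ← hg]
    refine Finset.sum_congr rfl fun i _ => ?_
    rw [e i, map_smul, smul_mul_assoc, TensorProduct.smul_tmul']
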